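/- An assignment problem $(N,O,\succsim)$ consists of a set $N=\{1,\dots,n\}$ of agents, a set $O=\{o_1,\dots,o_m\}$ of objects, and, for each agent $i\in N$, a complete and transitive relation $\succsim_i$ on $O$ (indifferences between objects are allowed). A discrete assignment is an $n\times m$ matrix $p=[p(i)(o)]$ with entries in $\{0,1\}$ such that $\sum_{i\in N}p(i)(o)=1$ for every $o\in O$. It is SD proportional if every agent SD prefers his allocation to the uniform one $(1/n,\dots,1/n)$, that is, if for all $i\in N$ and all $o\in O$ \[\sum_{o'\in O:\ o'\succsim_i o}p(i)(o')\ \ge\ \sum_{o'\in O:\ o'\succsim_i o}\frac1n .\] Theorem. It can be decided in polynomial time whether a given assignment problem, with indifferences allowed, has a discrete SD proportional assignment. That is, there are a (multi-stack) Turing machine and a polynomial $T$ such that, for every assignment problem, given as the bit string that lists $n$ and $m$ in unary followed by the $0$-$1$ matrices of the relations $\succsim_1,\dots,\succsim_n$, the machine halts within $T(\ell)$ steps, where $\ell=n+m+2+nm^2$ is the length of the string, and outputs $1$ if a discrete SD proportional assignment exists and $0$ otherwise. -/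

import Mathlib

/-- An assignment problem `(N, O, ≿)` with agents `Fin n` and objects `Fin m`. The proposition
`pref i a b = true` says that agent `i` finds object `a` at least as good as object `b`; each
agent's preference is complete and transitive, and indifferences are allowed. -/
structure AssignmentProblem where
  n : ℕ
  m : ℕ
  pref : Fin n → Fin m → Fin m → Bool
  complete : ∀ i a b, pref i a b = true ∨ pref i b a = true
  transitive : ∀ i a b c, pref i a b = true → pref i b c = true → pref i a c = true

namespace AssignmentProblem

/-- A fractional assignment: an `n × m` matrix with entries in `[0, 1]` in which every object is
completely allocated. The row `p i` is the allocation of agent `i`. -/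
def IsFractionalAssignment (I : AssignmentProblem) (p : Fin I.n → Fin I.m → ℝ) : Prop :=
  (∀ i o, p i o ∈ Set.Icc (0 : ℝ) 1) ∧ ∀ o, ∑ i, p i o = 1

/-- A discrete assignment: a fractional assignment all of whose entries are `0` or `1`. -/
def IsDiscreteAssignment (I : AssignmentProblem) (p : Fin I.n → Fin I.m → ℝ) : Prop :=
  I.IsFractionalAssignment p ∧ ∀ i o, p i o = 0 ∨ p i o = 1

/-- Agent `i` SD prefers (weakly) the allocation `x` to the allocation `y`: for each object `o`,
`x` gives at least as much as `y` of the objects that `i` finds at least as good as `o`. -/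
def SDPrefers (I : AssignmentProblem) (i : Fin I.n) (x y : Fin I.m → ℝ) : Prop :=
  ∀ o : Fin I.m,
    ∑ a ∈ Finset.univ.filter (fun a => I.pref i a o = true), y a ≤
      ∑ a ∈ Finset.univ.filter (fun a => I.pref i a o = true), x a

/-- SD proportionality: every agent SD prefers his allocation to `(1/n, …, 1/n)`. -/
def IsSDProportional (I : AssignmentProblem) (p : Fin I.n → Fin I.m → ℝ) : Prop :=
  ∀ i, I.SDPrefers i (p i) (fun _ => 1 / (I.n : ℝ))

/-- The bit string that presents an assignment problem to a machine: `n` and `m` in unary, each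
ended by `false`, and then the `n` preference relations as `m × m` matrices of bits, agent by agent
and row by row. Its length is `n + m + 2 + n * m * m`. -/
def encode (I : AssignmentProblem) : List Bool :=
  List.replicate I.n true ++ false :: (List.replicate I.m true ++ false ::
    (List.finRange I.n).flatMap fun i =>
      (List.finRange I.m).flatMap fun a =>
        (List.finRange I.m).map fun b => I.pref i a b)

theorem length_encode (I : AssignmentProblem) :
    I.encode.length = I.n + I.m + 2 + I.n * I.m * I.m := by
  simp [encode, List.length_flatMap]
  ring

theorem unary_prefix_inj : ∀ {a b : ℕ} {s t : List Bool},
    List.replicate a true ++ false :: s = List.replicate b true ++ false :: t → a = b ∧ s = t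
  | 0, 0, _, _, h => by simpa using h
  | 0, _ + 1, _, _, h => by simp [List.replicate_succ] at h
  | _ + 1, 0, _, _, h => by simp [List.replicate_succ] at h
  | a + 1, b + 1, s, t, h => by
    simp only [List.replicate_succ, List.cons_append, List.cons.injEq, true_and] at h
    obtain ⟨h1, h2⟩ := unary_prefix_inj h
    exact ⟨by rw [h1], h2⟩

theorem flatMap_inj_of_length {α : Type} {k : ℕ} {f g : α → List Bool}
    (hf : ∀ x, (f x).length = k) (hg : ∀ x, (g x).length = k) :
    ∀ l : List α, l.flatMap f = l.flatMap g → ∀ x ∈ l, f x = g x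
  | [], _, _, hx => by simp at hx
  | y :: l, h, x, hx => by
    simp only [List.flatMap_cons] at h
    obtain ⟨h1, h2⟩ := List.append_inj h (by rw [hf, hg])
    rcases List.mem_cons.1 hx with rfl | hx
    · exact h1
    · exact flatMap_inj_of_length hf hg l h2 x hx

/-- Different assignment problems have different encodings. -/
theorem encode_injective : Function.Injective encode := by
  rintro ⟨n, m, f, hf, hf'⟩ ⟨n', m', g, hg, hg'⟩ h
  obtain ⟨h1, h⟩ := unary_prefix_inj h
  obtain ⟨h2, h⟩ := unary_prefix_inj h
  dsimp only at h1 h2 h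
  subst h1 h2
  have key : f = g := by
    funext i a b
    have hi := flatMap_inj_of_length (k := m * m) (by intro; simp [List.length_flatMap])
      (by intro; simp [List.length_flatMap]) _ h i (List.mem_finRange i)
    have ha := flatMap_inj_of_length (k := m) (by intro; simp) (by intro; simp) _ hi a
      (List.mem_finRange a)
    exact List.map_inj_left.1 ha b (List.mem_finRange b)
  subst key
  rfl

end AssignmentProblem

/-- A decision problem `P` on the instances in `α`, presented as strings by `enc`, can be decided in
polynomial time: some multi-stack Turing machine answers, for every instance `a`, the correct bit
within a number of steps that is polynomial in the length of `enc a`. -/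
def DecidableInPolyTime {α Γ : Type} (enc : α → List Γ) (P : α → Prop) : Prop :=
  ∃ f : α → Bool, (∀ a, f a = true ↔ P a) ∧
    Nonempty (Turing.TM2ComputableInPolyTime enc Computability.encodeBool f)

/-!
The theorem has a combinatorial half and a machine half.

*Combinatorics.* An agent who shares `m` objects with `n` agents needs, for every upper set `U` of
his preference, at least `|U| / n` objects of `U`. Since the upper sets are nested, this can be
phrased with *slots*: the agent has slots `j` for all `j` with `j * n < m`, and slot `j` has to be
filled with an object to which at most `j * n` objects are strictly preferred. Discrete SD
proportional assignments exist exactly if all slots of all agents can be filled with different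
objects (`AssignmentProblem.exists_isSDProportional_iff`; Hall's theorem, for one agent at a time,
turns the objects of an agent into an assignment to his slots). Objects outside the matching can be
given to anybody.

Whether a bipartite graph has a matching that covers all `s` slots is decided by deferred
acceptance with `s` price levels (`DeferredAcceptance.hasMatching_iff`). Each slot goes through the
proposals (level, object) in lexicographic order, an object keeps the highest acceptable proposal,
and all rejected slots go on simultaneously. If everybody is kept in the end, the proposals are a
matching. If a slot runs out of proposals, then fewer than `s` objects are held, so that two
consecutive levels have the same set of objects held at or above them, and this set violates Hall's
condition. The state is a single number for each slot, and each round is given by a simple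
arithmetical formula.

*Machines.* Structured programs on stacks of bits (`StackProg`) translate into multi-stack Turing
machines that take the same number of steps (`StackProg.Runs.reachesIn`,
`StackProg.computableInPolyTime_of_runs`). Instead of writing a program for the whole algorithm, the
proof shows that number terms (`PolyTerm`), predicates (`PolyPred`) and commands on bit arrays
(`PolyCmd`) which programs evaluate in polynomial time have enough closure properties: arithmetic,
logical connectives, bounded sums, counting and quantifiers, reading and filling of arrays, and the
iteration of commands that preserve lengths. Numbers are kept in unary, so that bounded sums are
loops over a stack. Every step of the decision procedure is then polynomial because of the form of
its definition, with the pointers of deferred acceptance stored as rows of bits.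
-/

/-! ### Stack programs and their translation into Turing machines -/

/-- Structured programs on stacks of bits; the stacks are indexed by the natural numbers. -/
inductive StackProg : Type
  /-- Do nothing. -/
  | skip : StackProg
  /-- Push the bit `b` on stack `k`. -/
  | push (k : ℕ) (b : Bool) : StackProg
  /-- Pop stack `k`; go on with `p` if it was empty, and with `q b` if its top was `b`. -/
  | pop (k : ℕ) (p : StackProg) (q : Bool → StackProg) : StackProg
  /-- Run `p`, then `q`. -/
  | seq (p q : StackProg) : StackProg
  /-- As long as stack `k` is not empty, pop its top `b` and run `q b`. -/
  | loop (k : ℕ) (q : Bool → StackProg) : StackProg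

namespace StackProg

open Function

/-- `Runs p S S' t`: the program `p`, started with the stacks `S`, ends with the stacks `S'` after
at most `t` steps. -/
inductive Runs : StackProg → (ℕ → List Bool) → (ℕ → List Bool) → ℕ → Prop
  | skip (S) : Runs skip S S 1
  | push (k b S) : Runs (push k b) S (update S k (b :: S k)) 1
  | pop_nil {k p q S S' t} : S k = [] → Runs p S S' t → Runs (pop k p q) S S' (t + 1)
  | pop_cons {k p q S S' t b l} : S k = b :: l → Runs (q b) (update S k l) S' t →
      Runs (pop k p q) S S' (t + 1)
  | seq {p q S S' S'' t u} : Runs p S S' t → Runs q S' S'' u → Runs (seq p q) S S'' (t + u)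
  | loop_nil {k q S} : S k = [] → Runs (loop k q) S S 1
  | loop_cons {k q S S' S'' t u b l} : S k = b :: l → Runs (q b) (update S k l) S' t →
      Runs (loop k q) S' S'' u → Runs (loop k q) S S'' (t + u + 1)
  | mono {p S S' t t'} : Runs p S S' t → t ≤ t' → Runs p S S' t'

/-- The control locations of a program. -/
def Loc : StackProg → Type
  | skip => Unit
  | push _ _ => Unit
  | pop _ p q => Option (Loc p ⊕ Σ b, Loc (q b))
  | seq p q => Loc p ⊕ Loc q
  | loop _ q => Option (Σ b, Loc (q b))

/-- The location at which a program starts. -/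
def entry : (p : StackProg) → Loc p
  | skip => ()
  | push _ _ => ()
  | pop _ _ _ => none
  | seq p _ => Sum.inl (entry p)
  | loop _ _ => none

instance finite_loc : (p : StackProg) → Finite (Loc p)
  | skip => inferInstanceAs (Finite Unit)
  | push _ _ => inferInstanceAs (Finite Unit)
  | pop _ p q =>
    have := finite_loc p
    have := fun b => finite_loc (q b)
    inferInstanceAs (Finite (Option (Loc p ⊕ Σ b, Loc (q b))))
  | seq p q =>
    have := finite_loc p
    have := finite_loc q
    inferInstanceAs (Finite (Loc p ⊕ Loc q))
  | loop _ q =>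
    have := fun b => finite_loc (q b)
    inferInstanceAs (Finite (Option (Σ b, Loc (q b))))

/-- All stacks that the program mentions have an index less than `N`. -/
def Below (N : ℕ) : StackProg → Prop
  | skip => True
  | push k _ => k < N
  | pop k p q => k < N ∧ Below N p ∧ ∀ b, Below N (q b)
  | seq p q => Below N p ∧ Below N q
  | loop k q => k < N ∧ ∀ b, Below N (q b)

theorem Below.mono {N M : ℕ} (h : N ≤ M) : ∀ {p : StackProg}, Below N p → Below M p
  | skip, _ => trivial
  | push _ _, hp => lt_of_lt_of_le hp h
  | pop _ _ _, hp => ⟨hp.1.trans_le h, hp.2.1.mono h, fun b => (hp.2.2 b).mono h⟩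
  | seq _ _, hp => ⟨hp.1.mono h, hp.2.mono h⟩
  | loop _ _, hp => ⟨hp.1.trans_le h, fun b => (hp.2 b).mono h⟩

theorem exists_below : ∀ p : StackProg, ∃ N, Below N p
  | skip => ⟨0, trivial⟩
  | push k _ => ⟨k + 1, Nat.lt_succ_self k⟩
  | pop k p q => by
    obtain ⟨N, hN⟩ := exists_below p
    choose M hM using fun b => exists_below (q b)
    refine ⟨max (k + 1) (max N (max (M true) (M false))), by omega, hN.mono (by omega), ?_⟩
    rintro (_ | _) <;> exact (hM _).mono (by omega)
  | seq p q => by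
    obtain ⟨N, hN⟩ := exists_below p
    obtain ⟨M, hM⟩ := exists_below q
    exact ⟨max N M, hN.mono (by omega), hM.mono (by omega)⟩
  | loop k q => by
    choose M hM using fun b => exists_below (q b)
    refine ⟨max (k + 1) (max (M true) (M false)), by omega, ?_⟩
    rintro (_ | _) <;> exact (hM _).mono (by omega)

section Compile

variable {N : ℕ} {Λ : Type}

/-- Stack `k` of a program as a stack of the machine; this is faithful for `k ≤ N`. -/
def stackIdx (N k : ℕ) : Fin (N + 1) :=
  ⟨min k N, by omega⟩

theorem stackIdx_val {k : ℕ} (hk : k < N + 1) : (stackIdx N k : ℕ) = k := by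
  simp only [stackIdx]
  omega

/-- The machine code of a program with stacks `Fin (N + 1)`: `emb` places the locations of the
program among the labels of the machine, and `ex` is the label to go to at the end. The internal
state of the machine is the result of the last pop. -/
def code : (p : StackProg) → (Loc p → Λ) → Λ → Loc p →
    Turing.TM2.Stmt (fun _ : Fin (N + 1) => Bool) Λ (Option Bool)
  | skip, _, ex, _ => .goto fun _ => ex
  | push k b, _, ex, _ => .push (stackIdx N k) (fun _ => b) (.goto fun _ => ex)
  | pop k p q, emb, _, none => .pop (stackIdx N k) (fun _ o => o) (.goto fun o =>
      match o with
      | none => emb (some (.inl (entry p)))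
      | some b => emb (some (.inr ⟨b, entry (q b)⟩)))
  | pop _ p _, emb, ex, some (.inl l) => code p (fun l => emb (some (.inl l))) ex l
  | pop _ _ q, emb, ex, some (.inr ⟨b, l⟩) =>
      code (q b) (fun l => emb (some (.inr ⟨b, l⟩))) ex l
  | seq p q, emb, _, .inl l => code p (fun l => emb (.inl l)) (emb (.inr (entry q))) l
  | seq _ q, emb, ex, .inr l => code q (fun l => emb (.inr l)) ex l
  | loop k q, emb, ex, none => .pop (stackIdx N k) (fun _ o => o) (.goto fun o =>
      match o with
      | none => ex
      | some b => emb (some ⟨b, entry (q b)⟩))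
  | loop _ q, emb, _, some ⟨b, l⟩ => code (q b) (fun l => emb (some ⟨b, l⟩)) (emb none) l

/-- The machine `M` gets from the configuration `a` to the configuration `b` in at most `t`
steps. -/
def ReachesIn (M : Λ → Turing.TM2.Stmt (fun _ : Fin (N + 1) => Bool) Λ (Option Bool))
    (a b : Turing.TM2.Cfg (fun _ : Fin (N + 1) => Bool) Λ (Option Bool)) (t : ℕ) : Prop :=
  ∃ n ≤ t, (flip bind (Turing.TM2.step M))^[n] (some a) = some b

variable {M : Λ → Turing.TM2.Stmt (fun _ : Fin (N + 1) => Bool) Λ (Option Bool)}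
  {a b c : Turing.TM2.Cfg (fun _ : Fin (N + 1) => Bool) Λ (Option Bool)} {t u : ℕ}

theorem ReachesIn.trans (h : ReachesIn M a b t) (h' : ReachesIn M b c u) :
    ReachesIn M a c (t + u) := by
  obtain ⟨n, hn, h⟩ := h
  obtain ⟨n', hn', h'⟩ := h'
  exact ⟨n' + n, by omega, by rw [iterate_add_apply, h, h']⟩

theorem ReachesIn.mono (h : ReachesIn M a b t) (htu : t ≤ u) : ReachesIn M a b u :=
  let ⟨n, hn, h⟩ := h
  ⟨n, hn.trans htu, h⟩

theorem ReachesIn.single (h : Turing.TM2.step M a = some b) : ReachesIn M a b 1 :=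
  ⟨1, le_rfl, h⟩

theorem update_comp_val {k : ℕ} (hk : k < N + 1) (S : ℕ → List Bool) (l : List Bool) :
    (fun i : Fin (N + 1) => update S k l i) =
      update (fun i : Fin (N + 1) => S i) (stackIdx N k) l := by
  funext i
  by_cases h : i = stackIdx N k
  · subst h
    rw [update_self, stackIdx_val hk, update_self]
  · rw [update_of_ne h, update_of_ne]
    rintro rfl
    exact h (Fin.ext (stackIdx_val hk).symm)

/-- The code of a program does on the machine what the program does. -/
theorem Runs.reachesIn {p : StackProg} {S S' : ℕ → List Bool} {t : ℕ} (h : Runs p S S' t) :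
    Below (N + 1) p → ∀ (emb : Loc p → Λ) (ex : Λ), (∀ l, M (emb l) = code p emb ex l) →
      ∀ v, ∃ v', ReachesIn M ⟨some (emb (entry p)), v, fun i => S i⟩
        ⟨some ex, v', fun i => S' i⟩ t := by
  induction h with
  | skip S =>
    intro _ emb ex hM v
    refine ⟨v, .single ?_⟩
    change some (Turing.TM2.stepAux (M (emb ())) _ _) = _
    rw [hM ()]
    rfl
  | push k b S =>
    intro hp emb ex hM v
    refine ⟨v, .single ?_⟩
    change some (Turing.TM2.stepAux (M (emb ())) _ _) = _
    rw [update_comp_val hp, hM ()]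
    simp only [code, Turing.TM2.stepAux, stackIdx_val (show k < N + 1 from hp)]
  | @pop_nil k p q S S' t hk _ ih =>
    intro hp emb ex hM v
    obtain ⟨v', h⟩ := ih hp.2.1 (fun l => emb (some (.inl l))) ex (fun l => hM _) none
    refine ⟨v', ((ReachesIn.single ?_).trans h).mono (by omega)⟩
    change some (Turing.TM2.stepAux (M (emb none)) _ _) = _
    have : update (fun i : Fin (N + 1) => S i) (stackIdx N k) [] = fun i : Fin (N + 1) => S i := by
      rw [← update_comp_val hp.1, ← hk, update_eq_self]
    rw [hM none]
    simp only [code, Turing.TM2.stepAux, stackIdx_val hp.1, hk, List.head?_nil, List.tail_nil, this]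
  | @pop_cons k p q S S' t b l hk _ ih =>
    intro hp emb ex hM v
    obtain ⟨v', h⟩ := ih (hp.2.2 b) (fun l => emb (some (.inr ⟨b, l⟩))) ex (fun l => hM _) (some b)
    refine ⟨v', ((ReachesIn.single ?_).trans h).mono (by omega)⟩
    change some (Turing.TM2.stepAux (M (emb none)) _ _) = _
    rw [update_comp_val hp.1, hM none]
    simp only [code, Turing.TM2.stepAux, stackIdx_val hp.1, hk, List.head?_cons, List.tail_cons]
  | @seq p q S S' S'' t u _ _ ih ih' =>
    intro hp emb ex hM v
    obtain ⟨v', h⟩ := ih hp.1 (fun l => emb (.inl l)) (emb (.inr (entry q))) (fun l => hM _) v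
    obtain ⟨v'', h'⟩ := ih' hp.2 (fun l => emb (.inr l)) ex (fun l => hM _) v'
    exact ⟨v'', h.trans h'⟩
  | @loop_nil k q S hk =>
    intro hp emb ex hM v
    refine ⟨none, .single ?_⟩
    change some (Turing.TM2.stepAux (M (emb none)) _ _) = _
    have : update (fun i : Fin (N + 1) => S i) (stackIdx N k) [] = fun i : Fin (N + 1) => S i := by
      rw [← update_comp_val hp.1, ← hk, update_eq_self]
    rw [hM none]
    simp only [code, Turing.TM2.stepAux, stackIdx_val hp.1, hk, List.head?_nil, List.tail_nil, this]
  | @loop_cons k q S S' S'' t u b l hk _ _ ih ih' =>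
    intro hp emb ex hM v
    obtain ⟨v', h⟩ := ih (hp.2 b) (fun l => emb (some ⟨b, l⟩)) (emb none) (fun l => hM _) (some b)
    obtain ⟨v'', h'⟩ := ih' hp emb ex hM v'
    refine ⟨v'', (((ReachesIn.single ?_).trans h).trans h').mono (by omega)⟩
    change some (Turing.TM2.stepAux (M (emb none)) _ _) = _
    rw [update_comp_val hp.1, hM none]
    simp only [code, Turing.TM2.stepAux, stackIdx_val hp.1, hk, List.head?_cons, List.tail_cons]
  | mono _ htt' ih =>
    intro hp emb ex hM v
    obtain ⟨v', h⟩ := ih hp emb ex hM v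
    exact ⟨v', h.mono htt'⟩

end Compile

/-- The machine of a program: input on stack `0`, output on stack `out`. At the end of the program
it resets its internal state and halts. -/
noncomputable def machine (N : ℕ) (p : StackProg) (out : Fin (N + 1)) : Turing.FinTM2 where
  K := Fin (N + 1)
  k₀ := 0
  k₁ := out
  Γ _ := Bool
  Λ := Option (Loc p)
  ΛFin := Fintype.ofFinite _
  main := some (entry p)
  σ := Option Bool
  initialState := none
  m
    | none => .load (fun _ => none) .halt
    | some l => code p some none l

/-- A program that turns the code of `a` on stack `0` into the bit `f a` on stack `out`, in
polynomial time and with all other stacks empty at both ends, shows that `f` is computable in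
polynomial time. -/
theorem computableInPolyTime_of_runs {α : Type} {enc : α → List Bool} {f : α → Bool}
    {p : StackProg} {P : Polynomial ℕ} {out : ℕ}
    (h : ∀ a, Runs p (update (fun _ => []) 0 (enc a)) (update (fun _ => []) out [f a])
      (P.eval (enc a).length)) :
    Nonempty (Turing.TM2ComputableInPolyTime enc Computability.encodeBool f) := by
  obtain ⟨N, hN⟩ := exists_below p
  set N' := max N out with hN'
  have hp : Below (N' + 1) p := hN.mono (by omega)
  have hout : out < N' + 1 := by omega
  have key : ∀ a, ∃ n ≤ (P + 1).eval (enc a).length,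
      (flip bind (machine N' p (stackIdx N' out)).step)^[n]
        (some (Turing.initList (machine N' p (stackIdx N' out)) (enc a))) =
      some (Turing.haltList (machine N' p (stackIdx N' out)) [f a]) := by
    intro a
    obtain ⟨v', hv⟩ := (h a).reachesIn (M := (machine N' p (stackIdx N' out)).m) hp some none
      (fun l => rfl) none
    have h1 : ReachesIn (machine N' p (stackIdx N' out)).m
        ⟨some none, v', fun i => update (fun _ => []) out [f a] (i : ℕ)⟩
        ⟨none, none, fun i => update (fun _ => []) out [f a] (i : ℕ)⟩ 1 := .single rfl
    obtain ⟨n, hn, hr⟩ := hv.trans h1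
    refine ⟨n, by simpa using hn, ?_⟩
    have hi : Turing.initList (machine N' p (stackIdx N' out)) (enc a) =
        ⟨some (some (entry p)), none,
          fun i : Fin (N' + 1) => update (fun _ => []) 0 (enc a) (i : ℕ)⟩ := by
      refine congrArg (Turing.TM2.Cfg.mk _ _) (funext fun i : Fin (N' + 1) => ?_)
      by_cases hi : i = 0
      · subst hi; rfl
      · have h0 : (i : ℕ) ≠ 0 := fun h => hi (Fin.ext h)
        refine (dif_neg hi).trans ?_
        rw [update_of_ne h0]
        rfl
    have hh : Turing.haltList (machine N' p (stackIdx N' out)) [f a] =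
        ⟨none, none, fun i : Fin (N' + 1) => update (fun _ => []) out [f a] (i : ℕ)⟩ := by
      refine congrArg (Turing.TM2.Cfg.mk _ _) (funext fun i : Fin (N' + 1) => ?_)
      by_cases hi : i = stackIdx N' out
      · subst hi
        rw [stackIdx_val hout, update_self]
        exact dif_pos rfl
      · have h0 : (i : ℕ) ≠ out := fun h => hi (Fin.ext (h.trans (stackIdx_val hout).symm))
        refine (dif_neg hi).trans ?_
        rw [update_of_ne h0]
        rfl
    rw [hi, hh]
    exact hr
  choose n hn hr using key
  exact ⟨{
    tm := machine N' p (stackIdx N' out)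
    inputAlphabet := Equiv.refl _
    outputAlphabet := Equiv.refl _
    time := P + 1
    outputsFun := fun a =>
      { steps := n a
        evals_in_steps := by
          have := hr a
          rw [← List.map_id (enc a)] at this
          exact this
        steps_le_m := hn a } }⟩

end StackProg

/-! ### Running stack programs -/

namespace StackProg

open Function

theorem update_eq_self_of_eq {S : ℕ → List Bool} {k : ℕ} {l : List Bool} (h : S k = l) :
    update S k l = S := by
  rw [← h, update_eq_self]

theorem Runs.congr {p : StackProg} {S S₁ S₂ : ℕ → List Bool} {t u : ℕ} (h : Runs p S S₁ t)
    (hS : S₁ = S₂) (htu : t ≤ u) : Runs p S S₂ u :=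
  hS ▸ h.mono htu

/-- A loop whose counter is a stack of `N` bits `true` runs its body `N` times. -/
theorem runs_loop_replicate {k : ℕ} {q : Bool → StackProg} {T : ℕ} {N : ℕ}
    (σ : ℕ → ℕ → List Bool)
    (h : ∀ i < N, ∀ j, Runs (q true) (update (σ i) k (List.replicate j true))
      (update (σ (i + 1)) k (List.replicate j true)) T) :
    Runs (loop k q) (update (σ 0) k (List.replicate N true)) (update (σ N) k [])
      (N * (T + 1) + 1) := by
  induction N generalizing σ with
  | zero => exact (Runs.loop_nil (by simp)).mono (by omega)
  | succ N ih =>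
    have h1 := ih (fun i => σ (i + 1)) (fun i hi j => h (i + 1) (by omega) j)
    have h0 := h 0 (by omega) N
    refine (Runs.loop_cons (S := update (σ 0) k (List.replicate (N + 1) true))
      (b := true) (l := List.replicate N true) (by simp [List.replicate_succ]) (t := T) ?_ h1).mono
      (by rw [Nat.succ_mul]; omega)
    simpa using h0

theorem runs_clear (k : ℕ) : ∀ (l : List Bool) (S : ℕ → List Bool), S k = l →
    Runs (loop k fun _ => skip) S (update S k []) (2 * l.length + 1)
  | [], S, h => (Runs.loop_nil h).congr (update_eq_self_of_eq h).symm (by simp)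
  | b :: l, S, h => by
    refine (Runs.loop_cons h (Runs.skip _) (runs_clear k l _ (by simp))).congr (by simp) ?_
    simp only [List.length_cons]
    omega

/-- Moving stack `k` to stack `k'` reverses it. -/
theorem runs_move {k k' : ℕ} (hk : k ≠ k') : ∀ (l : List Bool) (S : ℕ → List Bool), S k = l →
    Runs (loop k fun b => push k' b) S (update (update S k' (l.reverse ++ S k')) k [])
      (2 * l.length + 1)
  | [], S, h => (Runs.loop_nil h).congr (by simp [update_eq_self_of_eq h]) (by simp)
  | b :: l, S, h => by
    refine (Runs.loop_cons h (Runs.push _ _ _) (runs_move hk l _ (by simp [hk]))).congr ?_ ?_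
    · funext j
      by_cases h1 : j = k
      · simp [h1]
      · by_cases h2 : j = k' <;> simp [h1, h2, hk.symm]
    · simp only [List.length_cons]
      omega

/-- Moving stack `k` to stack `k'` while counting its elements in unary on stack `e`. -/
theorem runs_move_count {k k' e : ℕ} (hk : k ≠ k') (he : k ≠ e) (he' : k' ≠ e) :
    ∀ (l : List Bool) (S : ℕ → List Bool), S k = l →
    Runs (loop k fun b => seq (push k' b) (push e true)) S
      (update (update (update S k' (l.reverse ++ S k')) e
        (List.replicate l.length true ++ S e)) k []) (3 * l.length + 1)
  | [], S, h => (Runs.loop_nil h).congr (by simp [update_eq_self_of_eq h]) (by simp)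
  | b :: l, S, h => by
    refine (Runs.loop_cons h (Runs.seq (Runs.push _ _ _) (Runs.push _ _ _))
      (runs_move_count hk he he' l _ (by simp [hk, he]))).congr ?_ ?_
    · funext j
      by_cases h1 : j = k
      · simp [h1]
      · by_cases h2 : j = k'
        · simp [h2, hk.symm, he']
        · by_cases h3 : j = e
          · subst h3
            simp [h2, h1, List.replicate_succ']
          · simp [h1, h2, h3]
    · simp only [List.length_cons]
      omega

/-- The program that pushes the length of stack `k` in unary on stack `d`, with stack `d + 1` as
scratch. -/
def copyLen (k d : ℕ) : StackProg :=
  seq (loop k fun b => push (d + 1) b) (loop (d + 1) fun b => seq (push k b) (push d true))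

theorem runs_copyLen {k d : ℕ} (hk : k < d) (S : ℕ → List Bool) (hd : S d = [])
    (hd' : S (d + 1) = []) :
    Runs (copyLen k d) S (update S d (List.replicate (S k).length true))
      (5 * (S k).length + 2) := by
  refine (Runs.seq (runs_move (k := k) (k' := d + 1) (by omega) _ S rfl)
    (runs_move_count (k := d + 1) (k' := k) (e := d) (by omega) (by omega) (by omega) _ _
      rfl)).congr ?_ ?_
  · funext j
    by_cases h1 : j = d + 1
    · subst h1
      simp [hd']
    · by_cases h2 : j = d
      · subst h2
        simp [hd, hd', hk.ne', show j + 1 ≠ k by omega]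
      · by_cases h3 : j = k
        · subst h3
          simp [h1, h2, hd', show d + 1 ≠ j by omega]
        · simp [h1, h2, h3]
  · rw [update_of_ne (by omega), update_self, hd', List.append_nil, List.length_reverse]
    omega

end StackProg

/-! ### Number terms that stack programs evaluate in polynomial time -/

section

open Function StackProg

/-- The size of a context: the values of its number variables and the lengths of its arrays. -/
def ctxSize {r c : ℕ} (v : Fin c → ℕ) (A : Fin r → List Bool) : ℕ :=
  ∑ i, v i + ∑ a, (A a).length

/-- The stacks `S` hold the context `(v, A)`: array `a` is stack `a`, variable `i` is the length of
stack `pos i`, and the stacks from `d` on are empty. -/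
structure Holds {r c : ℕ} (S : ℕ → List Bool) (d : ℕ) (pos : Fin c → ℕ) (v : Fin c → ℕ)
    (A : Fin r → List Bool) : Prop where
  arr : ∀ a : Fin r, S a = A a
  var : ∀ i, (S (pos i)).length = v i
  nil : ∀ k, d ≤ k → S k = []

/-- `f v A` is a number that depends on number variables `v` and bit arrays `A`, and it can be
evaluated by stack programs, in unary, in time polynomial in the size of the context. The programs
have to be able to work from any scratch level `d` on, wherever below it the variables are. -/
def PolyTerm {r c : ℕ} (f : (Fin c → ℕ) → (Fin r → List Bool) → ℕ) : Prop :=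
  ∀ (d : ℕ) (pos : Fin c → ℕ), r ≤ d → (∀ i, pos i < d) →
    ∃ (p : StackProg) (P : Polynomial ℕ), ∀ S v A, Holds S d pos v A →
      f v A ≤ P.eval (ctxSize v A) ∧
      Runs p S (update S d (List.replicate (f v A) true)) (P.eval (ctxSize v A))

open Classical in
/-- A predicate whose truth value, as a number `0` or `1`, is a `PolyTerm`. -/
def PolyPred {r c : ℕ} (φ : (Fin c → ℕ) → (Fin r → List Bool) → Prop) : Prop :=
  PolyTerm fun v A => if φ v A then 1 else 0

theorem polynomial_eval_mono (P : Polynomial ℕ) {a b : ℕ} (h : a ≤ b) : P.eval a ≤ P.eval b := by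
  rw [Polynomial.eval_eq_sum, Polynomial.eval_eq_sum]
  exact Finset.sum_le_sum fun i _ => Nat.mul_le_mul_left _ (Nat.pow_le_pow_left h i)

variable {r c : ℕ}

theorem Holds.of_eq {S S' : ℕ → List Bool} {d d' : ℕ} {pos v : Fin c → ℕ} {A : Fin r → List Bool}
    (h : Holds S d pos v A) (hr : r ≤ d) (hpos : ∀ i, pos i < d) (hS : ∀ k < d, S' k = S k)
    (hS' : ∀ k, d' ≤ k → S' k = []) : Holds S' d' pos v A :=
  ⟨fun a => by rw [hS a (by omega), h.arr], fun i => by rw [hS _ (hpos i), h.var], hS'⟩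

theorem Holds.update {S : ℕ → List Bool} {d : ℕ} {pos v : Fin c → ℕ} {A : Fin r → List Bool}
    (h : Holds S d pos v A) (hr : r ≤ d) (hpos : ∀ i, pos i < d) (l : List Bool) :
    Holds (update S d l) (d + 1) pos v A :=
  h.of_eq hr hpos (fun k hk => update_of_ne (by omega) _ _)
    fun k hk => by rw [update_of_ne (by omega), h.nil k (by omega)]

theorem Holds.cons {S : ℕ → List Bool} {d k i : ℕ} {pos v : Fin c → ℕ} {A : Fin r → List Bool}
    (h : Holds S d pos v A) (hk : (S k).length = i) :
    Holds S d (Fin.cons k pos : Fin (c + 1) → ℕ) (Fin.cons i v : Fin (c + 1) → ℕ) A :=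
  ⟨h.arr, fun j => by refine Fin.cases ?_ (fun j => ?_) j <;> simp [hk, h.var], h.nil⟩

theorem ctxSize_cons (i : ℕ) (v : Fin c → ℕ) (A : Fin r → List Bool) :
    ctxSize (Fin.cons i v : Fin (c + 1) → ℕ) A = i + ctxSize v A := by
  simp [ctxSize, Fin.sum_univ_succ]
  ring

theorem length_arr_le_ctxSize (v : Fin c → ℕ) (A : Fin r → List Bool) (a : Fin r) :
    (A a).length ≤ ctxSize v A :=
  (Finset.single_le_sum (f := fun a => (A a).length) (fun _ _ => Nat.zero_le _)
    (Finset.mem_univ a)).trans (Nat.le_add_left _ _)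

theorem var_le_ctxSize (v : Fin c → ℕ) (A : Fin r → List Bool) (i : Fin c) : v i ≤ ctxSize v A :=
  (Finset.single_le_sum (f := v) (fun _ _ => Nat.zero_le _)
    (Finset.mem_univ i)).trans (Nat.le_add_right _ _)

namespace PolyTerm

variable {f g : (Fin c → ℕ) → (Fin r → List Bool) → ℕ}

theorem zero : PolyTerm (r := r) (c := c) fun _ _ => 0 := fun d _ _ _ =>
  ⟨.skip, 1, fun S v A h => ⟨by simp, (Runs.skip S).congr
    (update_eq_self_of_eq (h.nil d le_rfl)).symm (by simp)⟩⟩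

theorem one : PolyTerm (r := r) (c := c) fun _ _ => 1 := fun d _ _ _ =>
  ⟨.push d true, 1, fun S v A h => ⟨by simp, (Runs.push d true S).congr
    (by simp [h.nil d le_rfl]) (by simp)⟩⟩

theorem var (i : Fin c) : PolyTerm (r := r) fun v _ => v i := fun d pos _ hpos =>
  ⟨copyLen (pos i) d, 5 * .X + 2, fun S v A h => by
    have := var_le_ctxSize v A i
    refine ⟨by simp; omega, (runs_copyLen (hpos i) S (h.nil d le_rfl)
      (h.nil _ (by omega))).congr (by rw [h.var]) ?_⟩
    rw [h.var]
    simp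
    omega⟩

theorem length (a : Fin r) : PolyTerm (c := c) fun _ A => (A a).length := fun d pos hr hpos =>
  ⟨copyLen a d, 5 * .X + 2, fun S v A h => by
    have := length_arr_le_ctxSize v A a
    refine ⟨by simp; omega, (runs_copyLen (by omega) S (h.nil d le_rfl)
      (h.nil _ (by omega))).congr (by rw [h.arr]) ?_⟩
    rw [h.arr]
    simp
    omega⟩

theorem add (hf : PolyTerm f) (hg : PolyTerm g) : PolyTerm fun v A => f v A + g v A := by
  intro d pos hr hpos
  obtain ⟨p, P, hp⟩ := hf d pos hr hpos
  obtain ⟨q, Q, hq⟩ := hg (d + 1) pos (by omega) fun i => (hpos i).trans (by omega)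
  refine ⟨.seq p (.seq q (.loop (d + 1) fun b => .push d b)), P + 3 * Q + 1, fun S v A h => ?_⟩
  obtain ⟨h1, h1'⟩ := hp S v A h
  obtain ⟨h2, h2'⟩ := hq _ v A (h.update hr hpos _)
  refine ⟨by simp; omega, (h1'.seq (h2'.seq
    (runs_move (k := d + 1) (k' := d) (by omega) _ _ rfl))).congr ?_ ?_⟩
  · funext j
    by_cases h3 : j = d + 1
    · subst h3
      simp [h.nil]
    · by_cases h4 : j = d
      · subst h4
        simp [List.replicate_append_replicate, Nat.add_comm]
      · simp [h3, h4]
  · simp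
    omega

theorem sub (hf : PolyTerm f) (hg : PolyTerm g) : PolyTerm fun v A => f v A - g v A := by
  intro d pos hr hpos
  obtain ⟨p, P, hp⟩ := hf d pos hr hpos
  obtain ⟨q, Q, hq⟩ := hg (d + 1) pos (by omega) fun i => (hpos i).trans (by omega)
  -- Popping an empty stack does nothing, which makes the subtraction truncated.
  refine ⟨.seq p (.seq q (.loop (d + 1) fun _ => .pop d .skip fun _ => .skip)),
    P + 4 * Q + 1, fun S v A h => ?_⟩
  obtain ⟨h1, h1'⟩ := hp S v A h
  obtain ⟨h2, h2'⟩ := hq _ v A (h.update hr hpos _)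
  have h3 := runs_loop_replicate (k := d + 1) (q := fun _ => .pop d .skip fun _ => .skip) (T := 2)
    (N := g v A) (fun i => update S d (List.replicate (f v A - i) true)) (fun i _ j => by
      rcases hfi : f v A - i with _ | n
      · refine (Runs.pop_nil (by simp) (Runs.skip _)).congr ?_ le_rfl
        rw [show f v A - (i + 1) = 0 by omega]
      · refine (Runs.pop_cons (b := true) (l := List.replicate n true)
          (by simp [List.replicate_succ]) (Runs.skip _)).congr ?_ le_rfl
        rw [show f v A - (i + 1) = n by omega, update_comm (by omega), update_idem])
  refine ⟨by simp; omega, (h1'.seq (h2'.seq h3)).congr ?_ ?_⟩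
  · exact update_eq_self_of_eq (by simp [h.nil])
  · simp
    omega

/-- Terms are closed under bounded sums. -/
theorem sum {g : ℕ → (Fin c → ℕ) → (Fin r → List Bool) → ℕ} (hf : PolyTerm f)
    (hg : PolyTerm fun (v : Fin (c + 1) → ℕ) A => g (v 0) (fun j => v j.succ) A) :
    PolyTerm fun v A => ∑ i ∈ Finset.range (f v A), g i v A := by
  intro d pos hr hpos
  obtain ⟨p, P, hp⟩ := hf d pos hr hpos
  obtain ⟨q, Q, hq⟩ := hg (d + 3) (Fin.cons (d + 1) pos) (by omega) fun i => by
    refine Fin.cases ?_ (fun j => ?_) i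
    · simp
    · simpa using (hpos j).trans (by omega)
  -- In each round the loop variable is at most `P`, so that `R` bounds the time for `g`.
  set R := Q.comp (P + .X) with hR
  refine ⟨.seq p (.seq (.loop d fun _ =>
      .seq q (.seq (.loop (d + 3) fun b => .push (d + 2) b) (.push (d + 1) true)))
    (.seq (.loop (d + 1) fun _ => .skip) (.loop (d + 2) fun b => .push d b))),
    P + (P * (3 * R + 3) + 1) + (2 * P + 1) + (2 * (P * R) + 1), fun S v A h => ?_⟩
  obtain ⟨h1, h1'⟩ := hp S v A h
  set s := ctxSize v A with hs
  set N := f v A with hN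
  have hgR : ∀ i < N, Q.eval (i + s) ≤ R.eval s := fun i hi => by
    rw [hR, Polynomial.eval_comp]
    exact polynomial_eval_mono _ (by simp; omega)
  -- The stores at the start of the rounds: stack `d + 1` counts the rounds, and stack `d + 2`
  -- holds the partial sum.
  let σ : ℕ → ℕ → List Bool := fun i => update (update S (d + 1) (List.replicate i true)) (d + 2)
    (List.replicate (∑ i ∈ Finset.range i, g i v A) true)
  have hround : ∀ i < N, g i v A ≤ R.eval s ∧ ∀ j,
      Runs (.seq q (.seq (.loop (d + 3) fun b => .push (d + 2) b) (.push (d + 1) true)))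
        (update (σ i) d (List.replicate j true)) (update (σ (i + 1)) d (List.replicate j true))
        (3 * R.eval s + 2) := by
    intro i hi
    have hh : ∀ j, Holds (update (σ i) d (List.replicate j true)) (d + 3)
        (Fin.cons (d + 1) pos : Fin (c + 1) → ℕ) (Fin.cons i v : Fin (c + 1) → ℕ) A := fun j => by
      refine (h.of_eq hr hpos (fun k hk => ?_) (fun k hk => ?_)).cons ?_
      · simp [σ, show k ≠ d by omega, show k ≠ d + 1 by omega, show k ≠ d + 2 by omega]
      · simp [σ, show k ≠ d by omega, show k ≠ d + 1 by omega, show k ≠ d + 2 by omega,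
          h.nil k (by omega)]
      · simp [σ]
    have hb : g i v A ≤ R.eval s := by
      have := (hq _ _ _ (hh 0)).1
      rw [ctxSize_cons] at this
      exact this.trans (hgR i hi)
    refine ⟨hb, fun j => ?_⟩
    have h3 : Runs q _ (update _ (d + 3) (List.replicate (g i v A) true)) _ := (hq _ _ _ (hh j)).2
    rw [ctxSize_cons] at h3
    refine (h3.seq ((runs_move (k := d + 3) (k' := d + 2) (by omega) _ _ rfl).seq
      (Runs.push _ _ _))).congr ?_ ?_
    · funext k
      by_cases k1 : k = d + 3
      · subst k1
        simp [σ, h.nil]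
      · by_cases k2 : k = d + 2
        · subst k2
          simp [σ, Finset.sum_range_succ, List.replicate_append_replicate, Nat.add_comm]
        · by_cases k3 : k = d + 1
          · subst k3
            simp [σ, List.replicate_succ]
          · by_cases k4 : k = d
            · subst k4
              simp [σ]
            · simp [σ, k1, k2, k3, k4]
    · have h4 := hgR i hi
      change Q.eval (i + s) + ((2 * (List.length _) + 1) + 1) ≤ _
      rw [update_self, List.length_replicate]
      omega
  have h3 := runs_loop_replicate (k := d) (N := N) (q := fun _ =>
    .seq q (.seq (.loop (d + 3) fun b => .push (d + 2) b) (.push (d + 1) true))) σ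
    (fun i hi => (hround i hi).2)
  have hsum : ∑ i ∈ Finset.range N, g i v A ≤ P.eval s * R.eval s := by
    calc ∑ i ∈ Finset.range N, g i v A ≤ ∑ i ∈ Finset.range N, R.eval s :=
          Finset.sum_le_sum fun i hi => (hround i (Finset.mem_range.1 hi)).1
      _ = N * R.eval s := by simp
      _ ≤ _ := Nat.mul_le_mul_right _ h1
  have h0 : update S d (List.replicate N true) = update (σ 0) d (List.replicate N true) := by
    congr 1
    simp only [σ]
    rw [List.replicate_zero, update_eq_self_of_eq (h.nil (d + 1) (by omega)), Finset.sum_range_zero,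
      List.replicate_zero, update_eq_self_of_eq (h.nil (d + 2) (by omega))]
  rw [h0] at h1'
  refine ⟨?_, (h1'.seq (h3.seq ((runs_clear (d + 1) _ _ rfl).seq
    (runs_move (k := d + 2) (k' := d) (by omega) _ _ rfl)))).congr ?_ ?_⟩
  · change ∑ i ∈ Finset.range N, g i v A ≤ _
    simp
    omega
  · change _ = update S d (List.replicate (∑ i ∈ Finset.range N, g i v A) true)
    funext k
    by_cases k2 : k = d + 2
    · subst k2
      simp [h.nil]
    · by_cases k3 : k = d + 1
      · subst k3
        simp [h.nil]
      · by_cases k4 : k = d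
        · subst k4
          simp [σ]
        · simp [σ, k2, k3, k4]
  · have e1 : (update (σ N) d [] (d + 1)).length = N := by simp [σ]
    have e2 : (update (update (σ N) d []) (d + 1) [] (d + 2)).length =
        ∑ i ∈ Finset.range N, g i v A := by simp [σ]
    rw [e1, e2]
    have : N * (3 * R.eval s + 2 + 1) ≤ P.eval s * (3 * R.eval s + 3) := Nat.mul_le_mul_right _ h1
    simp only [Polynomial.eval_add, Polynomial.eval_mul, Polynomial.eval_one,
      Polynomial.eval_ofNat]
    omega

/-- Terms are closed under reading a bit of an array; beyond its end an array reads `0`. -/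
theorem bit (a : Fin r) (hf : PolyTerm f) :
    PolyTerm fun v A => if (A a)[f v A]? = some true then 1 else 0 := by
  intro d pos hr hpos
  obtain ⟨p, P, hp⟩ := hf d pos hr hpos
  refine ⟨.seq p (.seq (.loop d fun _ => .pop a .skip fun b => .push (d + 1) b)
    (.seq (.pop a .skip fun b => .seq (.push a b) (if b then .push d true else .skip))
      (.loop (d + 1) fun b => .push a b))),
    P + (P * 3 + 1) + 3 + (2 * .X + 1), fun S v A h => ?_⟩
  obtain ⟨h1, h1'⟩ := hp S v A h
  set N := f v A with hN
  set l := A a with hl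
  have had : (a : ℕ) < d := by omega
  -- The program moves the first bits of the array to stack `d + 1`, inspects the next bit, and
  -- moves the bits back. The stores `σ i` are those after `i` bits have been moved.
  let σ : ℕ → ℕ → List Bool := fun i =>
    update (update S a (l.drop i)) (d + 1) (l.take i).reverse
  have h3 := runs_loop_replicate (k := d) (N := N) (T := 2)
    (q := fun _ => .pop a .skip fun b => .push (d + 1) b) σ (fun i hi j => by
      by_cases hil : i < l.length
      · refine (Runs.pop_cons (b := l[i]) (l := l.drop (i + 1)) ?_
          (Runs.push _ _ _)).congr ?_ le_rfl
        · simp [σ, had.ne, show (a : ℕ) ≠ d + 1 by omega]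
        · funext k
          by_cases k1 : k = d + 1
          · subst k1
            have e : (l.take (i + 1)).reverse = l[i] :: (l.take i).reverse := by
              rw [← List.take_append_getElem hil, List.reverse_append]
              rfl
            simp only [σ, e]
            simp [show d + 1 ≠ a by omega]
          · by_cases k2 : k = d
            · subst k2
              simp [had.ne']
            · by_cases k3 : k = a
              · subst k3
                simp [σ, k1, k2]
              · simp [σ, k1, k2, k3]
      · have e1 : l.drop i = [] := List.drop_eq_nil_of_le (by omega)
        have e2 : l.drop (i + 1) = [] := List.drop_eq_nil_of_le (by omega)
        refine (Runs.pop_nil ?_ (Runs.skip _)).congr ?_ le_rfl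
        · simp [σ, had.ne, show (a : ℕ) ≠ d + 1 by omega]
          omega
        · simp only [σ, e1, e2, List.take_of_length_le (show l.length ≤ i by omega),
            List.take_of_length_le (show l.length ≤ i + 1 by omega)])
  have h0 : update S d (List.replicate N true) = update (σ 0) d (List.replicate N true) := by
    congr 1
    simp only [σ, List.drop_zero, List.take_zero, List.reverse_nil]
    rw [update_eq_self_of_eq (h.arr a), update_eq_self_of_eq (h.nil (d + 1) (by omega))]
  rw [h0] at h1'
  have h4 : Runs (.pop a .skip fun b => .seq (.push a b) (if b then .push d true else .skip))
      (update (σ N) d [])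
      (update (σ N) d (List.replicate (if l[N]? = some true then 1 else 0) true)) 3 := by
    by_cases hil : N < l.length
    · refine (Runs.pop_cons (b := l[N]) (l := l.drop (N + 1)) (t := 2) ?_ ?_)
      · simp [σ, had.ne, show (a : ℕ) ≠ d + 1 by omega]
      · refine (Runs.push _ _ _).seq (u := 1) ?_
        have e : update (update (update (σ N) d []) a (l.drop (N + 1))) a
            (l[N] :: update (update (σ N) d []) a (l.drop (N + 1)) a) = update (σ N) d [] := by
          funext k
          by_cases k2 : k = a
          · subst k2
            simp [σ, had.ne, show (a : ℕ) ≠ d + 1 by omega]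
          · simp [k2]
        rw [e]
        rcases hb : l[N] with _ | _
        · simpa [hil, hb] using Runs.skip _
        · refine (Runs.push _ _ _).congr ?_ le_rfl
          simp [hil, hb]
    · refine (Runs.pop_nil ?_ (Runs.skip _)).congr ?_ (by omega)
      · simp [σ, had.ne, show (a : ℕ) ≠ d + 1 by omega]
        omega
      · simp [hil]
  have hlen : l.length ≤ ctxSize v A := length_arr_le_ctxSize v A a
  refine ⟨?_, (h1'.seq (h3.seq (h4.seq
    (runs_move (k := d + 1) (k' := a) (by omega) _ _ rfl)))).congr ?_ ?_⟩
  · simp only [Polynomial.eval_add, Polynomial.eval_one]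
    split_ifs <;> omega
  · change _ = update S d (List.replicate (if l[N]? = some true then 1 else 0) true)
    funext k
    by_cases k1 : k = d + 1
    · subst k1
      simp [h.nil]
    · by_cases k2 : k = d
      · subst k2
        simp [had.ne']
      · by_cases k3 : k = a
        · subst k3
          simp [σ, had.ne, show (a : ℕ) ≠ d + 1 by omega, h.arr, hl]
        · simp [σ, k1, k2, k3]
  · simp only [Polynomial.eval_add, Polynomial.eval_mul, Polynomial.eval_one,
      Polynomial.eval_ofNat, Polynomial.eval_X]
    have e1 : (update (σ N) d (List.replicate (if l[N]? = some true then 1 else 0) true)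
        (d + 1)).length ≤ l.length := by simp [σ]
    omega

end PolyTerm

end

/-! ### Arithmetic and logic on polynomial time terms -/

section

open Function StackProg

variable {r c : ℕ}

namespace PolyTerm

variable {f g : (Fin c → ℕ) → (Fin r → List Bool) → ℕ}

/-- A term may be used under one more bound variable. -/
theorem shift (hf : PolyTerm f) :
    PolyTerm fun (v : Fin (c + 1) → ℕ) A => f (fun j => v j.succ) A := by
  intro d pos hr hpos
  obtain ⟨p, P, hp⟩ := hf d (fun j => pos j.succ) hr fun j => hpos _
  refine ⟨p, P, fun S v A h => ?_⟩
  obtain ⟨h1, h2⟩ := hp S (fun j => v j.succ) A ⟨h.arr, fun j => h.var _, h.nil⟩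
  have : ctxSize (fun j => v j.succ) A ≤ ctxSize v A := by
    simp [ctxSize, Fin.sum_univ_succ]
  exact ⟨h1.trans (polynomial_eval_mono _ this), h2.mono (polynomial_eval_mono _ this)⟩

theorem mul (hf : PolyTerm f) (hg : PolyTerm g) : PolyTerm fun v A => f v A * g v A := by
  simpa using hf.sum (g := fun _ => g) hg.shift

end PolyTerm

namespace PolyPred

variable {φ ψ : (Fin c → ℕ) → (Fin r → List Bool) → Prop}
  {f g : (Fin c → ℕ) → (Fin r → List Bool) → ℕ}

theorem of_iff (hφ : PolyPred φ) (h : ∀ v A, ψ v A ↔ φ v A) : PolyPred ψ := by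
  have : ψ = φ := by
    funext v A
    exact propext (h v A)
  rwa [this]

theorem pos (hf : PolyTerm f) : PolyPred fun v A => 0 < f v A := by
  have := PolyTerm.one.sub (PolyTerm.one.sub hf)
  unfold PolyPred
  convert this using 3
  split_ifs <;> omega

theorem lt (hf : PolyTerm f) (hg : PolyTerm g) : PolyPred fun v A => f v A < g v A :=
  (pos (hg.sub hf)).of_iff fun _ _ => by omega

theorem not (hφ : PolyPred φ) : PolyPred fun v A => ¬ φ v A := by
  have := PolyTerm.one.sub hφ
  unfold PolyPred
  convert this using 3 with v A
  by_cases h : φ v A <;> simp [h]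

theorem and (hφ : PolyPred φ) (hψ : PolyPred ψ) : PolyPred fun v A => φ v A ∧ ψ v A := by
  have := hφ.mul hψ
  unfold PolyPred
  convert this using 3
  split_ifs <;> simp_all

theorem or (hφ : PolyPred φ) (hψ : PolyPred ψ) : PolyPred fun v A => φ v A ∨ ψ v A :=
  (hφ.not.and hψ.not).not.of_iff fun _ _ => by tauto

theorem le (hf : PolyTerm f) (hg : PolyTerm g) : PolyPred fun v A => f v A ≤ g v A :=
  (lt hg hf).not.of_iff fun _ _ => by omega

theorem eq (hf : PolyTerm f) (hg : PolyTerm g) : PolyPred fun v A => f v A = g v A :=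
  ((le hf hg).and (le hg hf)).of_iff fun _ _ => by omega

/-- Predicates are closed under bounded existential quantifiers. -/
theorem ex {φ : ℕ → (Fin c → ℕ) → (Fin r → List Bool) → Prop} (hf : PolyTerm f)
    (hφ : PolyPred fun (v : Fin (c + 1) → ℕ) A => φ (v 0) (fun j => v j.succ) A) :
    PolyPred fun v A => ∃ i < f v A, φ i v A := by
  classical
  have := pos (hf.sum (g := fun i v A => if φ i v A then 1 else 0) hφ)
  refine this.of_iff fun v A => ?_
  rw [Finset.sum_pos_iff]
  refine ⟨fun ⟨i, hi, h⟩ => ⟨i, by simpa using hi, by simp [h]⟩, fun ⟨i, hi, h⟩ =>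
    ⟨i, by simpa using hi, ?_⟩⟩
  by_contra hn
  simp [hn] at h

theorem all {φ : ℕ → (Fin c → ℕ) → (Fin r → List Bool) → Prop} (hf : PolyTerm f)
    (hφ : PolyPred fun (v : Fin (c + 1) → ℕ) A => φ (v 0) (fun j => v j.succ) A) :
    PolyPred fun v A => ∀ i < f v A, φ i v A :=
  (ex (φ := fun i v A => ¬ φ i v A) hf hφ.not).not.of_iff fun _ _ => by
    simp only [not_exists, not_and, not_not]

theorem bit (a : Fin r) (hf : PolyTerm f) : PolyPred fun v A => (A a)[f v A]? = some true := by
  have := hf.bit a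
  unfold PolyPred
  convert this

end PolyPred

open Classical in
/-- The number of indices below `N` with the property `φ`. -/
noncomputable def countBelow (N : ℕ) (φ : ℕ → Prop) : ℕ :=
  ∑ i ∈ Finset.range N, if φ i then 1 else 0

theorem countBelow_eq_card (N : ℕ) (φ : ℕ → Prop) [DecidablePred φ] :
    countBelow N φ = ((Finset.range N).filter φ).card := by
  rw [countBelow, Finset.card_filter]
  exact Finset.sum_congr rfl fun i _ => by congr

theorem countBelow_congr {N : ℕ} {φ ψ : ℕ → Prop} (h : ∀ i < N, φ i ↔ ψ i) :
    countBelow N φ = countBelow N ψ := by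
  classical
  rw [countBelow_eq_card, countBelow_eq_card]
  congr 1
  exact Finset.filter_congr fun i hi => h i (Finset.mem_range.1 hi)

/-- If exactly the first `k` indices have the property, then it is counted `k` times. -/
theorem countBelow_eq_of_lt {N k : ℕ} {φ : ℕ → Prop} (hk : k ≤ N) (h : ∀ i < N, φ i ↔ i < k) :
    countBelow N φ = k := by
  classical
  rw [countBelow_congr h, countBelow_eq_card]
  have : (Finset.range N).filter (· < k) = Finset.range k := by
    ext i
    simp
    omega
  rw [this, Finset.card_range]

namespace PolyTerm

variable {f g : (Fin c → ℕ) → (Fin r → List Bool) → ℕ}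

theorem count {φ : ℕ → (Fin c → ℕ) → (Fin r → List Bool) → Prop} (hf : PolyTerm f)
    (hφ : PolyPred fun (v : Fin (c + 1) → ℕ) A => φ (v 0) (fun j => v j.succ) A) :
    PolyTerm fun v A => countBelow (f v A) fun i => φ i v A :=
  hf.sum hφ

theorem div (hf : PolyTerm f) (hg : PolyTerm g) : PolyTerm fun v A => f v A / g v A := by
  -- The quotient is the number of `i` with `(i + 1) * g ≤ f`, except that division by `0`
  -- gives `0`.
  have := hf.count (φ := fun i v A => 0 < g v A ∧ (i + 1) * g v A ≤ f v A)
    ((PolyPred.pos hg.shift).and (.le (((var 0).add one).mul hg.shift) hf.shift))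
  convert this using 3 with v A
  symm
  refine countBelow_eq_of_lt (Nat.div_le_self _ _) fun i _ => ?_
  rcases Nat.eq_zero_or_pos (g v A) with h | h
  · simp [h]
  · rw [show i < f v A / g v A ↔ i + 1 ≤ f v A / g v A from Iff.rfl, Nat.le_div_iff_mul_le h]
    simp [h]

theorem mod (hf : PolyTerm f) (hg : PolyTerm g) : PolyTerm fun v A => f v A % g v A := by
  have := hf.sub (hg.mul (hf.div hg))
  convert this using 3 with v A
  have := Nat.div_add_mod (f v A) (g v A)
  omega

end PolyTerm

/-! ### Polynomial time commands on bit arrays -/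

/-- The stacks `S` with the first `r` of them replaced by the arrays `A`. -/
def store (S : ℕ → List Bool) (A : Fin r → List Bool) : ℕ → List Bool := fun k =>
  if h : k < r then A ⟨k, h⟩ else S k

/-- The map `F` on bit arrays can be carried out by stack programs in polynomial time. They may use
the stacks from any level `d` on, and leave those between the arrays and `d` as they are. -/
def PolyCmd (F : (Fin r → List Bool) → Fin r → List Bool) : Prop :=
  ∀ d, r ≤ d → ∃ (p : StackProg) (P : Polynomial ℕ), ∀ S A,
    Holds S d (Fin.elim0 : Fin 0 → ℕ) Fin.elim0 A →
      ctxSize (Fin.elim0 : Fin 0 → ℕ) (F A) ≤ P.eval (ctxSize (Fin.elim0 : Fin 0 → ℕ) A) ∧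
      Runs p S (store S (F A)) (P.eval (ctxSize (Fin.elim0 : Fin 0 → ℕ) A))

theorem Holds.store {S : ℕ → List Bool} {d : ℕ} {A : Fin r → List Bool} (hr : r ≤ d)
    (h : Holds S d (Fin.elim0 : Fin 0 → ℕ) Fin.elim0 A) (B : Fin r → List Bool) :
    Holds (store S B) d (Fin.elim0 : Fin 0 → ℕ) Fin.elim0 B :=
  ⟨fun a => by simp [_root_.store], fun i => i.elim0, fun k hk => by
    simp [_root_.store, show ¬ k < r by omega, h.nil k hk]⟩

theorem store_store (S : ℕ → List Bool) (A B : Fin r → List Bool) :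
    store (store S A) B = store S B := by
  funext k
  simp only [store]
  split_ifs <;> rfl

open Classical in
/-- The arrays `A` with array `a` replaced by the truth values of `φ i A` for `i < f A`. -/
noncomputable def fill (a : Fin r) (f : (Fin r → List Bool) → ℕ)
    (φ : ℕ → (Fin r → List Bool) → Prop) (A : Fin r → List Bool) : Fin r → List Bool :=
  update A a ((List.range (f A)).map fun i => decide (φ i A))

namespace PolyCmd

variable {F G : (Fin r → List Bool) → Fin r → List Bool}

theorem comp (hG : PolyCmd G) (hF : PolyCmd F) : PolyCmd fun A => G (F A) := by
  intro d hr
  obtain ⟨p, P, hp⟩ := hF d hr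
  obtain ⟨q, Q, hq⟩ := hG d hr
  refine ⟨.seq p q, P + Q.comp P, fun S A h => ?_⟩
  obtain ⟨h1, h1'⟩ := hp S A h
  obtain ⟨h2, h2'⟩ := hq _ _ (h.store hr (F A))
  have h3 := h2.trans (polynomial_eval_mono Q h1)
  have h4 := polynomial_eval_mono Q h1
  refine ⟨by simp; omega, (h1'.seq h2').congr (store_store _ _ _) (by simp; omega)⟩

theorem fill (a : Fin r) {f : (Fin r → List Bool) → ℕ} {φ : ℕ → (Fin r → List Bool) → Prop}
    (hf : PolyTerm fun (_ : Fin 0 → ℕ) A => f A)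
    (hφ : PolyPred fun (v : Fin 1 → ℕ) A => φ (v 0) A) :
    PolyCmd (fill a f φ) := by
  classical
  change PolyCmd fun A => update A a ((List.range (f A)).map fun i => decide (φ i A))
  intro d hr
  obtain ⟨p, P, hp⟩ := hf d Fin.elim0 hr fun i => i.elim0
  obtain ⟨q, Q, hq⟩ := hφ (d + 3) (fun _ => d + 1) (by omega) fun i => by omega
  set R := Q.comp (P + .X) with hR
  refine ⟨.seq p (.seq (.loop d fun _ => .seq q (.seq
      (.pop (d + 3) (.push (d + 2) false) fun _ => .push (d + 2) true) (.push (d + 1) true)))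
    (.seq (.loop (d + 1) fun _ => .skip) (.seq (.loop a fun _ => .skip)
      (.loop (d + 2) fun b => .push a b)))),
    P + (P * (R + 4) + 1) + (2 * P + 1) + (2 * .X + 1) + (2 * P + 1), fun S A h => ?_⟩
  obtain ⟨h1, h1'⟩ := hp S _ A h
  set s := ctxSize (Fin.elim0 : Fin 0 → ℕ) A with hs
  set N := f A with hN
  have had : (a : ℕ) < d := by omega
  -- The stores at the start of the rounds: stack `d + 1` counts the rounds, and stack `d + 2`
  -- holds the entries found so far, the last one on top.
  let σ : ℕ → ℕ → List Bool := fun i => update (update S (d + 1) (List.replicate i true)) (d + 2)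
    ((List.range i).map fun i => decide (φ i A)).reverse
  have hround : ∀ i < N, ∀ j,
      Runs (.seq q (.seq (.pop (d + 3) (.push (d + 2) false) fun _ => .push (d + 2) true)
          (.push (d + 1) true)))
        (update (σ i) d (List.replicate j true)) (update (σ (i + 1)) d (List.replicate j true))
        (R.eval s + 3) := by
    intro i hi j
    have hh : Holds (update (σ i) d (List.replicate j true)) (d + 3)
        (fun _ : Fin 1 => d + 1) (fun _ : Fin 1 => i) A := by
      refine ⟨fun b => ?_, fun _ => ?_, fun k hk => ?_⟩
      · simp [σ, show (b : ℕ) ≠ d by omega, show (b : ℕ) ≠ d + 1 by omega,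
          show (b : ℕ) ≠ d + 2 by omega, h.arr]
      · simp [σ]
      · simp [σ, show k ≠ d by omega, show k ≠ d + 1 by omega, show k ≠ d + 2 by omega,
          h.nil k (by omega)]
    have h3 : Runs q _ (update _ (d + 3) (List.replicate (if φ i A then 1 else 0) true)) _ :=
      (hq _ _ _ hh).2
    have hsize : Q.eval (ctxSize (fun _ : Fin 1 => i) A) ≤ R.eval s := by
      rw [hR, Polynomial.eval_comp]
      refine polynomial_eval_mono _ ?_
      have e : ctxSize (fun _ : Fin 1 => i) A = i + s := by simp [ctxSize, hs]
      replace h1 : N ≤ P.eval s := h1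
      rw [e]
      simp
      omega
    have e : (List.map (fun i => decide (φ i A)) (List.range (i + 1))).reverse =
        decide (φ i A) :: (List.map (fun i => decide (φ i A)) (List.range i)).reverse := by
      simp [List.range_succ]
    refine (h3.seq (Runs.seq (t := 2) (S' := update (update (σ i) d (List.replicate j true)) (d + 2)
      (List.map (fun i => decide (φ i A)) (List.range (i + 1))).reverse) ?_
      (Runs.push _ _ _))).congr ?_ (by omega)
    · by_cases hi : φ i A
      · refine (Runs.pop_cons (q := fun _ => .push (d + 2) true) (b := true) (l := []) ?_
          (Runs.push _ _ _)).congr ?_ le_rfl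
        · rw [update_self, if_pos hi]
          rfl
        rw [e]
        funext k
        by_cases k1 : k = d + 3
        · subst k1
          simp [σ, h.nil]
        · by_cases k2 : k = d + 2
          · subst k2
            simp [σ, hi]
          · simp [k1, k2]
      · refine (Runs.pop_nil (by simp [hi]) (Runs.push _ _ _)).congr ?_ le_rfl
        rw [e]
        funext k
        by_cases k1 : k = d + 3
        · subst k1
          simp [σ, h.nil, hi]
        · by_cases k2 : k = d + 2
          · subst k2
            simp [σ, hi]
          · simp [k1, k2]
    · funext k
      by_cases k2 : k = d + 2
      · subst k2
        simp [σ]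
      · by_cases k3 : k = d + 1
        · subst k3
          simp [σ, List.replicate_succ]
        · by_cases k4 : k = d
          · subst k4
            simp
          · simp [σ, k2, k3, k4]
  have h3 := runs_loop_replicate (k := d) (N := N) (q := fun _ => .seq q (.seq
    (.pop (d + 3) (.push (d + 2) false) fun _ => .push (d + 2) true) (.push (d + 1) true))) σ hround
  have h0 : update S d (List.replicate N true) = update (σ 0) d (List.replicate N true) := by
    congr 1
    simp only [σ]
    rw [List.replicate_zero, update_eq_self_of_eq (h.nil (d + 1) (by omega)), List.range_zero,
      List.map_nil, List.reverse_nil, update_eq_self_of_eq (h.nil (d + 2) (by omega))]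
  replace h1' : Runs p S (update S d (List.replicate N true)) _ := h1'
  rw [h0] at h1'
  refine ⟨?_, (h1'.seq (h3.seq ((runs_clear (d + 1) _ _ rfl).seq ((runs_clear a _ _ rfl).seq
    (runs_move (k := d + 2) (k' := a) (by omega) _ _ rfl))))).congr ?_ ?_⟩
  · have : ctxSize (Fin.elim0 : Fin 0 → ℕ)
        (update A a ((List.range N).map fun i => decide (φ i A))) ≤ s + N := by
      simp only [hs, ctxSize, Finset.univ_eq_empty, Finset.sum_empty, zero_add]
      rw [← Finset.add_sum_erase _ _ (Finset.mem_univ a),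
        ← Finset.add_sum_erase (a := a) _ (fun b => (A b).length) (Finset.mem_univ a)]
      have : ∀ b ∈ Finset.univ.erase a, (update A a
          ((List.range N).map fun i => decide (φ i A)) b).length = (A b).length := fun b hb => by
        rw [update_of_ne (Finset.ne_of_mem_erase hb)]
      rw [Finset.sum_congr rfl this]
      simp
      omega
    replace h1 : N ≤ P.eval s := h1
    refine this.trans ?_
    simp
    omega
  · funext k
    by_cases k1 : k = a
    · subst k1
      simp [σ, store, show d + 2 ≠ a by omega, show (a : ℕ) ≠ d + 2 by omega, hN]
    · have : store S (update A a ((List.range N).map fun i => decide (φ i A))) k = S k := by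
        simp only [store]
        split_ifs with hk
        · rw [update_of_ne (by rintro rfl; exact k1 rfl)]
          exact (h.arr ⟨k, hk⟩).symm
        · rfl
      change _ = store S (update A a ((List.range N).map fun i => decide (φ i A))) k
      rw [this]
      by_cases k2 : k = d + 2
      · subst k2
        simp [h.nil]
      · by_cases k3 : k = d + 1
        · subst k3
          simp [h.nil, k1]
        · by_cases k4 : k = d
          · subst k4
            simp [h.nil, k1]
          · simp [σ, k1, k2, k3, k4]
  · have e1 : (update (σ N) d [] (d + 1)).length = N := by simp [σ]
    have e2 : (update (update (σ N) d []) (d + 1) [] a).length ≤ s := by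
      have : (A a).length ≤ s := length_arr_le_ctxSize _ A a
      simpa [σ, had.ne, show (a : ℕ) ≠ d + 1 by omega, show (a : ℕ) ≠ d + 2 by omega, h.arr]
    have e3 : (update (update (update (σ N) d []) (d + 1) []) a [] (d + 2)).length = N := by
      simp [σ, show d + 2 ≠ a by omega]
    rw [e1, e3]
    replace h1 : N ≤ P.eval s := h1
    have : N * (R.eval s + 3 + 1) ≤ P.eval s * (R.eval s + 4) := Nat.mul_le_mul_right _ h1
    simp only [Polynomial.eval_add, Polynomial.eval_mul, Polynomial.eval_one,
      Polynomial.eval_ofNat, Polynomial.eval_X]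
    omega

/-- A command that does not change the lengths of the arrays can be iterated. -/
theorem iterate (hF : PolyCmd F) (hlen : ∀ A a, (F A a).length = (A a).length)
    {f : (Fin r → List Bool) → ℕ} (hf : PolyTerm fun (_ : Fin 0 → ℕ) A => f A) :
    PolyCmd fun A => F^[f A] A := by
  intro d hr
  obtain ⟨p, P, hp⟩ := hf d Fin.elim0 hr fun i => i.elim0
  obtain ⟨q, Q, hq⟩ := hF (d + 1) (by omega)
  refine ⟨.seq p (.loop d fun _ => q), P + (P * (Q + 1) + 1) + .X, fun S A h => ?_⟩
  obtain ⟨h1, h1'⟩ := hp S _ A h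
  set s := ctxSize (Fin.elim0 : Fin 0 → ℕ) A with hs
  replace h1 : f A ≤ P.eval s := h1
  replace h1' : Runs p S (update S d (List.replicate (f A) true)) _ := h1'
  have hsize : ∀ i, ctxSize (Fin.elim0 : Fin 0 → ℕ) (F^[i] A) = s := by
    intro i
    induction i with
    | zero => rfl
    | succ i ih =>
      rw [iterate_succ_apply', ← ih]
      simp only [ctxSize, hlen]
  have hround : ∀ i < f A, ∀ j, Runs q
      (update (store S (F^[i] A)) d (List.replicate j true))
      (update (store S (F^[i + 1] A)) d (List.replicate j true)) (Q.eval s) := by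
    intro i _ j
    have hh : Holds (update (store S (F^[i] A)) d (List.replicate j true)) (d + 1)
        (Fin.elim0 : Fin 0 → ℕ) Fin.elim0 (F^[i] A) :=
      (h.store hr _).update hr (fun i => i.elim0) _
    have := (hq _ _ hh).2
    rw [hsize] at this
    refine this.congr ?_ le_rfl
    rw [← iterate_succ_apply' F]
    funext k
    by_cases k1 : k = d
    · subst k1
      simp [store, show ¬ k < r by omega]
    · simp only [store, update_of_ne k1]
      split_ifs <;> rfl
  have h3 := runs_loop_replicate (k := d) (N := f A) (q := fun _ => q)
    (fun i => store S (F^[i] A)) hround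
  have h0 : store S (F^[0] A) = S := by
    funext k
    simp only [store]
    split_ifs with hk
    · exact (h.arr ⟨k, hk⟩).symm
    · rfl
  rw [h0] at h3
  refine ⟨?_, (h1'.seq h3).congr ?_ ?_⟩
  · rw [hsize]
    simp
  · exact update_eq_self_of_eq (by simp [store, show ¬ d < r by omega, h.nil])
  · have : f A * (Q.eval s + 1) ≤ P.eval s * (Q.eval s + 1) := Nat.mul_le_mul_right _ h1
    simp
    omega

/-- With two arrays, of which the first holds the input and the second is empty at first, the
predicate `ψ` on the result of the command `F` can be decided in polynomial time. -/
theorem computableInPolyTime {α : Type} {enc : α → List Bool}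
    {F : (Fin 2 → List Bool) → Fin 2 → List Bool} (hF : PolyCmd F)
    {ψ : (Fin 2 → List Bool) → Prop} (hψ : PolyPred fun (_ : Fin 0 → ℕ) A => ψ A) {f : α → Bool}
    (h : ∀ a, f a = true ↔ ψ (F ![enc a, []])) :
    Nonempty (Turing.TM2ComputableInPolyTime enc Computability.encodeBool f) := by
  classical
  obtain ⟨p, P, hp⟩ := hF 2 le_rfl
  obtain ⟨q, Q, hq⟩ := hψ 2 Fin.elim0 le_rfl fun i => i.elim0
  refine computableInPolyTime_of_runs (out := 2) (p := .seq p (.seq q (.seq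
    (.loop 0 fun _ => .skip) (.seq (.loop 1 fun _ => .skip)
      (.pop 2 (.push 2 false) fun _ => .push 2 true)))))
    (P := P + Q.comp P + (2 * P + 1) + (2 * P + 1) + 2) fun a => ?_
  have h0 : Holds (update (fun _ => []) 0 (enc a)) 2 (Fin.elim0 : Fin 0 → ℕ) Fin.elim0
      ![enc a, []] :=
    ⟨fun b => by fin_cases b <;> simp, fun i => i.elim0, fun k hk => by
      simp [show k ≠ 0 by omega]⟩
  have hs : ctxSize (Fin.elim0 : Fin 0 → ℕ) ![enc a, []] = (enc a).length := by simp [ctxSize]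
  obtain ⟨h1, h1'⟩ := hp _ _ h0
  rw [hs] at h1 h1'
  set B := F ![enc a, []] with hB
  have h0' := h0.store le_rfl B
  obtain ⟨-, h2⟩ := hq _ _ _ h0'
  have hfa : (if ψ B then 1 else 0) = if f a then 1 else 0 := by
    by_cases hfa : f a = true
    · rw [if_pos hfa, if_pos ((h a).1 hfa)]
    · rw [if_neg hfa, if_neg (mt (h a).2 hfa)]
  replace h2 : Runs q (store (update (fun _ => []) 0 (enc a)) B) (update
      (store (update (fun _ => []) 0 (enc a)) B) 2 (List.replicate (if f a then 1 else 0) true))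
      (Q.eval (ctxSize (Fin.elim0 : Fin 0 → ℕ) B)) := by
    rw [← hfa]
    exact h2
  refine (h1'.seq (h2.seq ((runs_clear 0 _ _ rfl).seq ((runs_clear 1 _ _ rfl).seq (u := 2) (S'' :=
    update (fun _ => []) 2 [f a]) ?_)))).mono ?_
  · have e : ∀ k, k ≠ 2 → update (update (update (store (update (fun _ => []) 0 (enc a)) B) 2
        (List.replicate (if f a then 1 else 0) true)) 0 []) 1 [] k = [] := by
      intro k hk
      by_cases k0 : k = 0
      · simp [k0]
      · by_cases k1 : k = 1
        · simp [k1]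
        · simp [k0, k1, hk, store, show ¬ k < 2 by omega]
    rcases hb : f a with _ | _
    · rw [hb] at e
      refine (Runs.pop_nil (by simp) (Runs.push _ _ _)).congr ?_ le_rfl
      funext k
      by_cases k2 : k = 2
      · subst k2
        simp
      · rw [update_of_ne k2, e k k2, update_of_ne k2]
    · rw [hb] at e
      refine (Runs.pop_cons (q := fun _ => .push 2 true) (b := true) (l := []) (by simp)
        (Runs.push _ _ _)).congr ?_ le_rfl
      funext k
      by_cases k2 : k = 2
      · subst k2
        simp
      · rw [update_of_ne k2, update_of_ne k2, e k k2, update_of_ne k2]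
  · have h3 := polynomial_eval_mono Q h1
    have e0 : (B 0).length ≤ ctxSize (Fin.elim0 : Fin 0 → ℕ) B := length_arr_le_ctxSize _ B 0
    have e1 : (B 1).length ≤ ctxSize (Fin.elim0 : Fin 0 → ℕ) B := length_arr_le_ctxSize _ B 1
    have l0 : (update (store (update (fun _ => []) 0 (enc a)) B) 2
        (List.replicate (if f a then 1 else 0) true) 0).length = (B 0).length := by
      simp [store]
    have l1 : (update (update (store (update (fun _ => []) 0 (enc a)) B) 2
        (List.replicate (if f a then 1 else 0) true)) 0 [] 1).length = (B 1).length := by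
      simp [store]
    rw [l0, l1]
    simp only [Polynomial.eval_add, Polynomial.eval_mul, Polynomial.eval_one,
      Polynomial.eval_ofNat, Polynomial.eval_comp]
    omega

end PolyCmd

end

/-! ### Deferred acceptance with price levels -/

/-- Slots `x < s` and objects `o < m` have a matching that covers all slots and respects `nb`. -/
def HasMatching (s m : ℕ) (nb : ℕ → ℕ → Prop) : Prop :=
  ∃ g : ℕ → ℕ, (∀ x < s, g x < m ∧ nb x (g x)) ∧ ∀ x < s, ∀ y < s, g x = g y → x = y

namespace DeferredAcceptance

variable (s m : ℕ) (nb : ℕ → ℕ → Prop)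

/-- The state of the procedure is a pointer `t x` for each slot `x`: the slot is proposing to the
object `t x % m` at the price level `t x / m`, and it has given up if `t x = s * m`. Slot `x'`
beats slot `x` if both propose to the same object, that object is acceptable to `x'`, and `x'`
offers the higher price; ties go to the slot with the smaller index. -/
def Beats (t : ℕ → ℕ) (x' x : ℕ) : Prop :=
  t x' < s * m ∧ t x' % m = t x % m ∧ nb x' (t x % m) ∧ (t x < t x' ∨ t x = t x' ∧ x' < x)

/-- The current proposal of slot `x` fails: the object is not acceptable to `x`, or another slot
beats `x`. -/
def Rejected (t : ℕ → ℕ) (x : ℕ) : Prop :=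
  t x < s * m ∧ (¬ nb x (t x % m) ∨ ∃ x' < s, Beats s m nb t x' x)

open Classical in
/-- One round: all rejected slots go on to their next proposal. -/
noncomputable def round (t : ℕ → ℕ) (x : ℕ) : ℕ :=
  if Rejected s m nb t x then t x + 1 else t x

/-- Some slot to which object `o` is acceptable proposes to it, and its pointer is at least `j`. -/
def HeldFrom (t : ℕ → ℕ) (o j : ℕ) : Prop :=
  ∃ x < s, t x < s * m ∧ t x % m = o ∧ nb x o ∧ j ≤ t x

/-- The invariant of the procedure: an acceptable object that a slot has passed over is held at
the price level at which the slot was rejected, or a higher one. -/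
def Inv (t : ℕ → ℕ) : Prop :=
  ∀ x < s, t x ≤ s * m ∧ ∀ j < t x, nb x (j % m) → HeldFrom s m nb t (j % m) j

variable {s m nb} {t : ℕ → ℕ}

/-- The best proposal for an object is not rejected; this is why objects, once held, stay held at
the same or a higher price. -/
theorem HeldFrom.exists_not_rejected {o j : ℕ} (h : HeldFrom s m nb t o j) :
    ∃ x < s, (t x < s * m ∧ t x % m = o ∧ nb x o ∧ j ≤ t x) ∧ ¬ Rejected s m nb t x := by
  classical
  obtain ⟨x₀, hx₀, h₀⟩ := h
  -- The key orders the slots by pointer first and then by decreasing index.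
  obtain ⟨x, hx, hmax⟩ := Finset.exists_max_image
    ((Finset.range s).filter fun x => t x < s * m ∧ t x % m = o ∧ nb x o ∧ j ≤ t x)
    (fun x => t x * (s + 1) + (s - x)) ⟨x₀, by simpa using ⟨hx₀, h₀⟩⟩
  simp only [Finset.mem_filter, Finset.mem_range] at hx hmax
  obtain ⟨hxs, hxt, hxo, hxn, hxj⟩ := hx
  refine ⟨x, hxs, ⟨hxt, hxo, hxn, hxj⟩, ?_⟩
  rintro ⟨-, hn | ⟨x', hx', h1, h2, h3, h4⟩⟩
  · rw [hxo] at hn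
    exact hn hxn
  · rw [hxo] at h2 h3
    have := hmax x' ⟨hx', h1, h2, h3, by omega⟩
    rcases h4 with h4 | ⟨h4, h5⟩
    · have h6 : (t x + 1) * (s + 1) ≤ t x' * (s + 1) := Nat.mul_le_mul_right _ h4
      rw [Nat.succ_mul] at h6
      omega
    · rw [h4] at this
      omega

theorem HeldFrom.round {o j : ℕ} (h : HeldFrom s m nb t o j) :
    HeldFrom s m nb (round s m nb t) o j := by
  obtain ⟨x, hx, h1, h2⟩ := h.exists_not_rejected
  exact ⟨x, hx, by simpa [DeferredAcceptance.round, h2] using h1⟩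

theorem Inv.round (h : Inv s m nb t) : Inv s m nb (round s m nb t) := by
  intro x hx
  obtain ⟨h1, h2⟩ := h x hx
  by_cases hr : Rejected s m nb t x
  · have e : DeferredAcceptance.round s m nb t x = t x + 1 := if_pos hr
    refine ⟨by have := hr.1; omega, fun j hj hnb => HeldFrom.round ?_⟩
    rcases Nat.lt_succ_iff_lt_or_eq.1 (e ▸ hj) with hj | rfl
    · exact h2 j hj hnb
    · obtain ⟨-, hn | ⟨x', hx', h3, h4, h5, h6⟩⟩ := hr
      · exact absurd hnb hn
      · exact ⟨x', hx', h3, h4, h5, by omega⟩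
  · have e : DeferredAcceptance.round s m nb t x = t x := if_neg hr
    exact ⟨by omega, fun j hj hnb => (h2 j (e ▸ hj) hnb).round⟩

theorem Inv.iterate (h : Inv s m nb t) (i : ℕ) :
    Inv s m nb ((DeferredAcceptance.round s m nb)^[i] t) := by
  induction i with
  | zero => exact h
  | succ i ih =>
    rw [Function.iterate_succ_apply']
    exact ih.round

theorem inv_zero : Inv s m nb fun _ => 0 :=
  fun _ _ => ⟨Nat.zero_le _, fun _ hj => absurd hj (Nat.not_lt_zero _)⟩

theorem le_round (t : ℕ → ℕ) (x : ℕ) : t x ≤ round s m nb t x := by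
  unfold round
  split_ifs <;> omega

/-- The pointers cannot grow more than `s * (s * m)` times in total, so that no slot is rejected
after that many rounds. -/
theorem not_rejected_iterate (h : Inv s m nb t) :
    ∀ x < s, ¬ Rejected s m nb ((round s m nb)^[s * (s * m) + 1] t) x := by
  have key : ∀ i, (∀ x < s, ¬ Rejected s m nb ((round s m nb)^[i] t) x) ∨
      i ≤ ∑ x ∈ Finset.range s, (round s m nb)^[i] t x := by
    intro i
    induction i with
    | zero => exact .inr (Nat.zero_le _)
    | succ i ih =>
      rw [Function.iterate_succ_apply']
      set u := (round s m nb)^[i] t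
      by_cases hu : ∀ x < s, ¬ Rejected s m nb u x
      · refine .inl fun x hx hr => hu x hx ?_
        have e : ∀ y < s, round s m nb u y = u y := fun y hy => if_neg (hu y hy)
        obtain ⟨h1, h2⟩ := hr
        rw [e x hx] at h1 h2
        refine ⟨h1, h2.imp_right ?_⟩
        rintro ⟨x', hx', h3⟩
        refine ⟨x', hx', ?_⟩
        unfold Beats at h3 ⊢
        rwa [e x hx, e x' hx'] at h3
      · refine .inr ((Nat.succ_le_succ (ih.resolve_left hu)).trans ?_)
        push Not at hu
        obtain ⟨x, hx, hr⟩ := hu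
        refine Nat.succ_le_of_lt (Finset.sum_lt_sum (fun y _ => le_round u y)
          ⟨x, Finset.mem_range.2 hx, ?_⟩)
        rw [show round s m nb u x = u x + 1 from if_pos hr]
        exact Nat.lt_succ_self _
  refine (key _).resolve_right fun hle => ?_
  have := Finset.sum_le_card_nsmul (Finset.range s)
    (fun x => (round s m nb)^[s * (s * m) + 1] t x) (s * m)
    fun x hx => (h.iterate _ x (Finset.mem_range.1 hx)).1
  rw [Finset.card_range, smul_eq_mul] at this
  omega

/-- When no slot is rejected and no slot has given up, the proposals form a matching. -/
theorem hasMatching_of_not_rejected (hr : ∀ x < s, ¬ Rejected s m nb t x)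
    (ht : ∀ x < s, t x < s * m) : HasMatching s m nb := by
  have hnb : ∀ x < s, nb x (t x % m) := fun x hx => by
    by_contra hn
    exact hr x hx ⟨ht x hx, .inl hn⟩
  refine ⟨fun x => t x % m, fun x hx => ⟨Nat.mod_lt _ ?_, hnb x hx⟩, fun x hx y hy hxy => ?_⟩
  · exact Nat.pos_of_mul_pos_left (Nat.zero_lt_of_lt (ht x hx))
  · by_contra hne
    have h1 : ¬ Beats s m nb t y x := fun hb => hr x hx ⟨ht x hx, .inr ⟨y, hy, hb⟩⟩
    have h2 : ¬ Beats s m nb t x y := fun hb => hr y hy ⟨ht y hy, .inr ⟨x, hx, hb⟩⟩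
    have hxy' : t x % m = t y % m := hxy
    have h3 := hnb x hx
    have h4 := hnb y hy
    simp only [Beats, not_and, not_or] at h1 h2
    have h5 := h1 (ht y hy) hxy'.symm (hxy' ▸ h4)
    have h6 := h2 (ht x hx) hxy' (hxy' ▸ h3)
    omega

/-- If a slot has given up, Hall's condition fails. With fewer held objects than price levels, some
two consecutive levels `k` and `k + 1` have the same set of objects held at or above them. The
holders of these objects, together with the slot that has given up, find no other object
acceptable. -/
theorem not_hasMatching_of_eq (h : Inv s m nb t) {x₀ : ℕ} (hx₀ : x₀ < s) (ht : t x₀ = s * m) :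
    ¬ HasMatching s m nb := by
  classical
  rintro ⟨g, hg, hginj⟩
  have hm : 0 < m := Nat.zero_lt_of_lt (hg x₀ hx₀).1
  let H : ℕ → Finset ℕ := fun k => (Finset.range m).filter fun o => HeldFrom s m nb t o (k * m)
  have hH : ∀ k o, o ∈ H k ↔ o < m ∧ HeldFrom s m nb t o (k * m) := fun k o => by simp [H]
  have hanti : ∀ k, H (k + 1) ⊆ H k := fun k o ho => by
    rw [hH] at ho ⊢
    obtain ⟨ho, x, hx, h1, h2, h3, h4⟩ := ho
    exact ⟨ho, x, hx, h1, h2, h3, by rw [Nat.succ_mul] at h4; omega⟩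
  have hcard : (H 0).card + 1 ≤ s := by
    have : (H 0).card ≤ ((Finset.range s).erase x₀).card := by
      choose! w hw using fun o (ho : o ∈ H 0) => ((hH 0 o).1 ho).2
      refine Finset.card_le_card_of_injOn w (fun o ho => ?_) fun o ho o' ho' he => ?_
      · obtain ⟨h1, h2, h3⟩ := hw o ho
        refine Finset.mem_coe.2 (Finset.mem_erase.2 ⟨?_, Finset.mem_range.2 h1⟩)
        rintro he
        rw [he] at h2
        omega
      · rw [← (hw o ho).2.2.1, ← (hw o' ho').2.2.1, he]
    rw [Finset.card_erase_of_mem (Finset.mem_range.2 hx₀), Finset.card_range] at this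
    omega
  obtain ⟨k, hk, hkk⟩ : ∃ k < s, H (k + 1) = H k := by
    by_contra! hne
    have : ∀ k ≤ s, (H k).card + k + 1 ≤ s := by
      intro k
      induction k with
      | zero => intro _; omega
      | succ k ih =>
        intro hk
        have h1 := ih (by omega)
        have h2 := Finset.card_lt_card ((hanti k).ssubset_of_ne (hne k (by omega)))
        omega
    have := this s le_rfl
    omega
  choose! w hw using fun o (ho : o ∈ H (k + 1)) => ((hH (k + 1) o).1 ho).2
  have hX : x₀ ∉ (H (k + 1)).image w := by
    intro hx
    obtain ⟨o, ho, he⟩ := Finset.mem_image.1 hx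
    have := (hw o ho).2.1
    rw [he] at this
    omega
  have hinj : Set.InjOn w (H (k + 1)) := fun o ho o' ho' he => by
    rw [← (hw o ho).2.2.1, ← (hw o' ho').2.2.1, he]
  -- An object acceptable to a slot whose pointer has passed level `k` is held at level `k`.
  have hpass : ∀ x < s, (k + 1) * m ≤ t x → g x ∈ H k := by
    intro x hx hkx
    obtain ⟨h1, h2⟩ := hg x hx
    have e : (k * m + g x) % m = g x := by
      rw [Nat.add_comm, Nat.add_mul_mod_self_right, Nat.mod_eq_of_lt h1]
    have := (h x hx).2 (k * m + g x) (by rw [Nat.succ_mul] at hkx; omega) (by rwa [e])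
    rw [e] at this
    obtain ⟨y, hy, h3, h4, h5, h6⟩ := this
    exact (hH k _).2 ⟨h1, y, hy, h3, h4, h5, by omega⟩
  have hmap : ∀ x ∈ insert x₀ ((H (k + 1)).image w), x < s ∧ g x ∈ H (k + 1) := by
    intro x hx
    rw [hkk]
    rcases Finset.mem_insert.1 hx with rfl | hx
    · exact ⟨hx₀, hpass _ hx₀ (ht ▸ Nat.mul_le_mul_right _ hk)⟩
    · obtain ⟨o, ho, rfl⟩ := Finset.mem_image.1 hx
      obtain ⟨h1, -, -, -, h2⟩ := hw o ho
      exact ⟨h1, hpass _ h1 h2⟩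
  have := Finset.card_le_card_of_injOn g (fun x hx => (hmap x hx).2)
    fun x hx y hy he => hginj x (hmap x hx).1 y (hmap y hy).1 he
  rw [Finset.card_insert_of_notMem hX, Finset.card_image_of_injOn hinj] at this
  omega

/-- The pointers after sufficiently many rounds tell whether there is a matching. -/
theorem hasMatching_iff : HasMatching s m nb ↔
    ∀ x < s, (round s m nb)^[s * (s * m) + 1] (fun _ => 0) x < s * m := by
  have hinv := (inv_zero (s := s) (m := m) (nb := nb)).iterate (s * (s * m) + 1)
  refine ⟨fun h x hx => ?_, hasMatching_of_not_rejected (not_rejected_iterate inv_zero)⟩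
  by_contra hn
  exact not_hasMatching_of_eq hinv hx (le_antisymm (hinv x hx).1 (by omega)) h

end DeferredAcceptance

/-! ### SD proportional assignments as matchings -/

/-- The number of slots of each agent when `n` agents share `m` objects, that is `m / n` rounded
up (and `m` if `n = 0`). -/
noncomputable def quota (n m : ℕ) : ℕ :=
  countBelow m fun j => j * n < m

/-- Slot `x` belongs to agent `x / q`, with `q = quota n m`, and it is the slot number `j = x % q`
of this agent. It accepts an object `o` if at most `j * n` objects are strictly better for the
agent. The relation `R i a b` says that agent `i` finds `a` at least as good as `b`. -/
def Accepts (n m : ℕ) (R : ℕ → ℕ → ℕ → Prop) (x o : ℕ) : Prop :=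
  countBelow m (fun a => ¬ R (x / quota n m) o a) ≤ x % quota n m * n

theorem lt_quota_iff {n m j : ℕ} (hn : 0 < n) : j < quota n m ↔ j * n < m := by
  -- The numbers `j` with `j * n < m` form an initial segment, of length `(m + n - 1) / n`.
  have h1 : ∀ i, i < (m + n - 1) / n ↔ i * n < m := fun i => by
    rw [show i < (m + n - 1) / n ↔ i + 1 ≤ (m + n - 1) / n from Iff.rfl,
      Nat.le_div_iff_mul_le hn, Nat.succ_mul]
    omega
  have h2 : quota n m = (m + n - 1) / n := by
    refine countBelow_eq_of_lt ?_ fun i _ => (h1 i).symm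
    by_contra! h
    have := (h1 m).1 h
    nlinarith
  rw [h2, h1]

theorem countBelow_eq_card_fin {m : ℕ} (φ : ℕ → Prop) [DecidablePred φ] :
    countBelow m φ = (Finset.univ.filter fun a : Fin m => φ a).card := by
  rw [countBelow_eq_card]
  symm
  refine Finset.card_bij (fun (a : Fin m) _ => (a : ℕ)) (fun a ha => ?_)
    (fun a _ b _ h => Fin.ext h) fun a ha => ?_
  · simpa using ha
  · simp only [Finset.mem_filter, Finset.mem_range] at ha
    exact ⟨⟨a, ha.1⟩, by simpa using ha.2, rfl⟩

namespace AssignmentProblem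

variable (I : AssignmentProblem)

/-- The objects that agent `i` finds at least as good as `o`. -/
def upper (i : Fin I.n) (o : Fin I.m) : Finset (Fin I.m) :=
  Finset.univ.filter fun a => I.pref i a o = true

/-- The objects that agent `i` finds strictly better than `o`. -/
def above (i : Fin I.n) (o : Fin I.m) : Finset (Fin I.m) :=
  Finset.univ.filter fun a => ¬ I.pref i o a = true

variable {I}

theorem mem_upper {i : Fin I.n} {a o : Fin I.m} : a ∈ I.upper i o ↔ I.pref i a o = true := by
  simp [upper]

theorem mem_above {i : Fin I.n} {a o : Fin I.m} : a ∈ I.above i o ↔ ¬ I.pref i o a = true := by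
  simp [above]

theorem pref_refl (i : Fin I.n) (a : Fin I.m) : I.pref i a a = true :=
  (I.complete i a a).elim id id

theorem upper_ssubset {i : Fin I.n} {a o : Fin I.m} (h : ¬ I.pref i a o = true) :
    I.upper i o ⊂ I.upper i a := by
  have h' := (I.complete i a o).resolve_left h
  refine (Finset.ssubset_iff_of_subset fun b hb => ?_).2 ⟨a, ?_, ?_⟩
  · exact mem_upper.2 (I.transitive i b o a (mem_upper.1 hb) h')
  · exact mem_upper.2 (pref_refl i a)
  · rwa [mem_upper]

theorem exists_worst (i : Fin I.n) {X : Finset (Fin I.m)} (hX : X.Nonempty) :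
    ∃ o ∈ X, ∀ a ∈ X, I.pref i a o = true := by
  obtain ⟨o, ho, hmax⟩ := X.exists_max_image (fun a => (I.upper i a).card) hX
  refine ⟨o, ho, fun a ha => ?_⟩
  by_contra hn
  exact absurd (hmax a ha) (not_le.2 (Finset.card_lt_card (upper_ssubset hn)))

/-- The smallest upper set with more than `k` objects contains only objects to which at most `k`
objects are strictly preferred. -/
theorem exists_upper (i : Fin I.n) {k : ℕ} (hk : k < I.m) :
    ∃ o, k < (I.upper i o).card ∧ ∀ b ∈ I.upper i o, (I.above i b).card ≤ k := by
  have hne : (Finset.univ.filter fun o => k < (I.upper i o).card).Nonempty := by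
    obtain ⟨o, -, ho⟩ := exists_worst i (X := (Finset.univ : Finset (Fin I.m)))
      ⟨⟨k, hk⟩, Finset.mem_univ _⟩
    refine ⟨o, ?_⟩
    have : I.upper i o = Finset.univ := Finset.eq_univ_of_forall fun a =>
      mem_upper.2 (ho a (Finset.mem_univ a))
    simpa [this] using hk
  obtain ⟨o, ho, hmin⟩ := Finset.exists_min_image _ (fun o => (I.upper i o).card) hne
  simp only [Finset.mem_filter, Finset.mem_univ, true_and] at ho hmin
  refine ⟨o, ho, fun b hb => ?_⟩
  by_contra! hlt
  -- The objects strictly better than `b` would lie in a smaller upper set with the same property.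
  obtain ⟨o', ho', hworst⟩ := exists_worst i (X := I.above i b)
    (Finset.card_pos.1 (by omega))
  have h1 : I.above i b ⊆ I.upper i o' := fun a ha => mem_upper.2 (hworst a ha)
  have h2 := hmin o' (hlt.trans_le (Finset.card_le_card h1))
  refine absurd h2 (not_le.2 (Finset.card_lt_card (upper_ssubset fun h => ?_)))
  exact mem_above.1 ho' (I.transitive i b o o' (mem_upper.1 hb) h)

theorem card_above_eq {R : ℕ → ℕ → ℕ → Prop}
    (hR : ∀ (i : Fin I.n) (a b : Fin I.m), R i a b ↔ I.pref i a b = true) (i : Fin I.n)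
    (o : Fin I.m) : countBelow I.m (fun a => ¬ R i o a) = (I.above i o).card := by
  classical
  rw [countBelow_eq_card_fin]
  congr 1
  ext a
  simp [above, hR]

theorem sum_eq_card_filter {i : Fin I.n} {p : Fin I.n → Fin I.m → ℝ} (hp : I.IsDiscreteAssignment p)
    (X : Finset (Fin I.m)) : ∑ a ∈ X, p i a = (X.filter fun a => p i a = 1).card := by
  rw [Finset.card_filter, Nat.cast_sum]
  refine Finset.sum_congr rfl fun a _ => ?_
  rcases hp.2 i a with h | h <;> simp [h]

theorem eq_of_eq_one {p : Fin I.n → Fin I.m → ℝ} (hp : I.IsDiscreteAssignment p) {i i' : Fin I.n}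
    {o : Fin I.m} (h : p i o = 1) (h' : p i' o = 1) : i = i' := by
  by_contra hne
  have h1 := hp.1.2 o
  have h2 := Finset.sum_le_sum_of_subset_of_nonneg (f := fun i => p i o)
    (Finset.subset_univ {i, i'}) fun j _ _ => (hp.1.1 j o).1
  rw [Finset.sum_pair hne, h1, h, h'] at h2
  norm_num at h2

/-- The objects that an agent gets in a discrete SD proportional assignment can be put into his
slots. -/
theorem exists_slot_objects {p : Fin I.n → Fin I.m → ℝ} (hp : I.IsDiscreteAssignment p)
    (hsd : I.IsSDProportional p) (i : Fin I.n) :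
    ∃ f : Fin (quota I.n I.m) → Fin I.m, Function.Injective f ∧
      ∀ j, p i (f j) = 1 ∧ (I.above i (f j)).card ≤ j * I.n := by
  classical
  have hn : 0 < I.n := i.pos
  let t : Fin (quota I.n I.m) → Finset (Fin I.m) := fun j =>
    Finset.univ.filter fun o => p i o = 1 ∧ (I.above i o).card ≤ j * I.n
  have ht : ∀ j : Fin (quota I.n I.m), (j : ℕ) + 1 ≤ (t j).card := by
    intro j
    obtain ⟨o, ho, ho'⟩ := exists_upper i ((lt_quota_iff hn).1 j.2)
    have h1 := hsd i o
    rw [sum_eq_card_filter hp, Finset.sum_const, nsmul_eq_mul, mul_one_div,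
      div_le_iff₀ (by exact_mod_cast hn)] at h1
    have h2 : (I.upper i o).card ≤ ((I.upper i o).filter fun a => p i a = 1).card * I.n := by
      exact_mod_cast h1
    have h3 : ((I.upper i o).filter fun a => p i a = 1).card ≤ (t j).card :=
      Finset.card_le_card fun a ha => by
        rw [Finset.mem_filter] at ha
        exact Finset.mem_filter.2 ⟨Finset.mem_univ _, ha.2, ho' a ha.1⟩
    exact Nat.lt_of_mul_lt_mul_right ((ho.trans_le h2).trans_le (Nat.mul_le_mul_right _ h3))
  obtain ⟨f, hf, hft⟩ := (Finset.all_card_le_biUnion_card_iff_exists_injective t).1 fun J => by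
    rcases J.eq_empty_or_nonempty with rfl | hJ
    · simp
    -- The sets `t j` increase with `j`, so that only the largest member of `J` matters.
    · obtain ⟨j, hj, hmax⟩ := J.exists_max_image (fun j => (j : ℕ)) hJ
      calc J.card ≤ (Finset.range (j + 1)).card :=
            Finset.card_le_card_of_injOn (fun j => (j : ℕ))
              (fun k hk => by simpa using Nat.lt_succ_of_le (hmax k hk))
              fun a _ b _ h => Fin.val_injective h
        _ = j + 1 := Finset.card_range _
        _ ≤ (t j).card := ht j
        _ ≤ _ := Finset.card_le_card (Finset.subset_biUnion_of_mem t hj)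
  exact ⟨f, hf, fun j => by simpa [t] using hft j⟩

theorem hasMatching_of_isSDProportional {R : ℕ → ℕ → ℕ → Prop}
    (hR : ∀ (i : Fin I.n) (a b : Fin I.m), R i a b ↔ I.pref i a b = true)
    {p : Fin I.n → Fin I.m → ℝ} (hp : I.IsDiscreteAssignment p) (hsd : I.IsSDProportional p) :
    HasMatching (I.n * quota I.n I.m) I.m (Accepts I.n I.m R) := by
  set q := quota I.n I.m with hq
  choose f hf hfp using exists_slot_objects hp hsd
  have hdiv : ∀ {x}, x < I.n * q → x / q < I.n ∧ x % q < q := fun {x} hx => by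
    have : 0 < q := Nat.pos_of_mul_pos_left (Nat.zero_lt_of_lt hx)
    exact ⟨(Nat.div_lt_iff_lt_mul this).2 hx, Nat.mod_lt _ this⟩
  let g : ℕ → ℕ := fun x => if h : x / q < I.n ∧ x % q < q then f ⟨x / q, h.1⟩ ⟨x % q, h.2⟩ else 0
  have hg : ∀ {x} (hx : x < I.n * q),
      g x = f ⟨x / q, (hdiv hx).1⟩ ⟨x % q, (hdiv hx).2⟩ := fun hx => dif_pos (hdiv hx)
  refine ⟨g, fun x hx => ?_, fun x hx y hy hxy => ?_⟩
  · rw [hg hx]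
    refine ⟨Fin.isLt _, ?_⟩
    have := (hfp ⟨x / q, (hdiv hx).1⟩ ⟨x % q, (hdiv hx).2⟩).2
    rw [← card_above_eq hR] at this
    exact this
  · rw [hg hx, hg hy] at hxy
    have hxy := Fin.ext hxy
    have h1 := (hfp ⟨x / q, (hdiv hx).1⟩ ⟨x % q, (hdiv hx).2⟩).1
    have h2 := (hfp ⟨y / q, (hdiv hy).1⟩ ⟨y % q, (hdiv hy).2⟩).1
    rw [← hxy] at h2
    have h3 := eq_of_eq_one hp h1 h2
    rw [← h3] at hxy
    have h4 := congrArg Fin.val (hf _ hxy)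
    have h5 := congrArg Fin.val h3
    simp only at h4 h5
    rw [← Nat.div_add_mod x q, ← Nat.div_add_mod y q, h4, h5]

theorem exists_isSDProportional_of_hasMatching {R : ℕ → ℕ → ℕ → Prop}
    (hR : ∀ (i : Fin I.n) (a b : Fin I.m), R i a b ↔ I.pref i a b = true) (hn : 0 < I.n)
    (h : HasMatching (I.n * quota I.n I.m) I.m (Accepts I.n I.m R)) :
    ∃ p, I.IsDiscreteAssignment p ∧ I.IsSDProportional p := by
  classical
  set q := quota I.n I.m with hq
  obtain ⟨g, hg, hginj⟩ := h
  -- The objects outside the matching all go to the same agent.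
  have hown : ∀ o : Fin I.m, ∃ i : Fin I.n, ∀ x < I.n * q, g x = o → x / q = i := by
    intro o
    by_cases ho : ∃ x < I.n * q, g x = o
    · obtain ⟨x, hx, hxo⟩ := ho
      have : 0 < q := Nat.pos_of_mul_pos_left (Nat.zero_lt_of_lt hx)
      refine ⟨⟨x / q, (Nat.div_lt_iff_lt_mul this).2 hx⟩, fun y hy hyo => ?_⟩
      rw [hginj y hy x hx (hyo.trans hxo.symm)]
    · exact ⟨⟨0, hn⟩, fun x hx hxo => absurd ⟨x, hx, hxo⟩ ho⟩
  choose own hown using hown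
  have hp : I.IsDiscreteAssignment fun i o => if own o = i then 1 else 0 := by
    refine ⟨⟨fun i o => ?_, fun o => by simp⟩, fun i o => ?_⟩
    · dsimp only
      split_ifs <;> simp
    · dsimp only
      split_ifs <;> simp
  refine ⟨_, hp, fun i o => ?_⟩
  rw [sum_eq_card_filter hp, Finset.sum_const, nsmul_eq_mul, mul_one_div,
    div_le_iff₀ (by exact_mod_cast hn)]
  change ((I.upper i o).card : ℝ) ≤ ((I.upper i o).filter _).card * I.n
  set K := ((I.upper i o).filter fun a => (if own a = i then (1 : ℝ) else 0) = 1).card with hK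
  suffices h : (I.upper i o).card ≤ K * I.n by exact_mod_cast h
  by_contra! hlt
  have hm : (I.upper i o).card ≤ I.m := by simpa using Finset.card_le_univ (I.upper i o)
  -- The first `K + 1` slots of the agent all hold objects at least as good as `o`.
  have hslot : ∀ j ∈ Finset.range (K + 1), i * q + j < I.n * q ∧
      ∃ h : g (i * q + j) < I.m, (⟨g (i * q + j), h⟩ : Fin I.m) ∈
        (I.upper i o).filter fun a => (if own a = i then (1 : ℝ) else 0) = 1 := by
    intro j hj
    have hj : j * I.n ≤ K * I.n := Nat.mul_le_mul_right _ (by simpa [Nat.lt_succ_iff] using hj)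
    have hjq : j < q := (lt_quota_iff hn).2 (by omega)
    have h1 : i * q + j < I.n * q := by
      have : (i + 1) * q ≤ I.n * q := Nat.mul_le_mul_right _ i.2
      rw [Nat.succ_mul] at this
      omega
    obtain ⟨h2, h3⟩ := hg _ h1
    have e1 : (i * q + j) / q = i := by
      rw [Nat.add_comm, Nat.add_mul_div_right _ _ (by omega), Nat.div_eq_of_lt hjq, zero_add]
    have e2 : (i * q + j) % q = j := by
      rw [Nat.add_comm, Nat.add_mul_mod_self_right, Nat.mod_eq_of_lt hjq]
    refine ⟨h1, h2, Finset.mem_filter.2 ⟨?_, ?_⟩⟩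
    · unfold Accepts at h3
      rw [← hq, e1, e2, card_above_eq hR i ⟨_, h2⟩] at h3
      rw [mem_upper]
      by_contra hn'
      have : I.upper i o ⊆ I.above i ⟨_, h2⟩ := fun a ha => by
        rw [mem_above]
        exact fun h => hn' (I.transitive i _ a o h (mem_upper.1 ha))
      have := Finset.card_le_card this
      omega
    · rw [if_pos]
      exact Fin.ext ((hown ⟨_, h2⟩ _ h1 rfl).symm.trans e1)
  have := Finset.card_le_card_of_injOn (s := Finset.range (K + 1))
    (t := ((I.upper i o).filter fun a => (if own a = i then (1 : ℝ) else 0) = 1).image Fin.val)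
    (fun j => g (i * q + j))
    (fun j hj => by
      obtain ⟨-, h2, h3⟩ := hslot j hj
      exact Finset.mem_coe.2 (Finset.mem_image_of_mem _ h3))
    fun j hj k hk he => by
      have := hginj _ (hslot j hj).1 _ (hslot k hk).1 he
      omega
  rw [Finset.card_range, Finset.card_image_of_injective _ Fin.val_injective] at this
  omega

/-- A discrete SD proportional assignment is a matching of the slots, up to the case of objects
without agents. -/
theorem exists_isSDProportional_iff {R : ℕ → ℕ → ℕ → Prop}
    (hR : ∀ (i : Fin I.n) (a b : Fin I.m), R i a b ↔ I.pref i a b = true) :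
    (∃ p, I.IsDiscreteAssignment p ∧ I.IsSDProportional p) ↔
      (0 < I.n ∨ I.m = 0) ∧ HasMatching (I.n * quota I.n I.m) I.m (Accepts I.n I.m R) := by
  constructor
  · rintro ⟨p, hp, hsd⟩
    refine ⟨?_, hasMatching_of_isSDProportional hR hp hsd⟩
    -- Without agents no object can be allocated.
    by_contra! h
    have h1 := hp.1.2 ⟨0, Nat.pos_of_ne_zero h.2⟩
    have : IsEmpty (Fin I.n) := ⟨fun i => by have := i.2; omega⟩
    simp at h1
  · rintro ⟨hn, h⟩
    rcases Nat.eq_zero_or_pos I.n with hn0 | hn0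
    · have hm := hn.resolve_left (by omega)
      have : IsEmpty (Fin I.m) := ⟨fun o => by have := o.2; omega⟩
      exact ⟨fun _ _ => 0, ⟨⟨fun _ o => isEmptyElim o, fun o => isEmptyElim o⟩,
        fun _ o => isEmptyElim o⟩, fun _ o => isEmptyElim o⟩
    · exact exists_isSDProportional_of_hasMatching hR hn0 h

end AssignmentProblem

/-! ### The decision procedure on bit strings -/

section

open Function

/-- The length of the block of bits `true` that starts at position `k` of the string `l`. -/
noncomputable def blockLength (l : List Bool) (k : ℕ) : ℕ :=
  countBelow l.length fun x => ∀ y < x + 1, l[k + y]? = some true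

/-- The number of agents that a string announces. -/
noncomputable def agentsOf (l : List Bool) : ℕ :=
  blockLength l 0

/-- The number of objects that a string announces. -/
noncomputable def objectsOf (l : List Bool) : ℕ :=
  blockLength l (agentsOf l + 1)

/-- The preferences in a string: agent `i` finds object `a` at least as good as object `b`. -/
def prefOf (l : List Bool) (i a b : ℕ) : Prop :=
  l[agentsOf l + objectsOf l + 2 + ((i * objectsOf l + a) * objectsOf l + b)]? = some true

/-- The number of slots in the matching problem of a string. -/
noncomputable def slotsOf (l : List Bool) : ℕ :=
  agentsOf l * quota (agentsOf l) (objectsOf l)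

/-- The number of proposals that each slot can make in the matching problem of a string. -/
noncomputable def proposalsOf (l : List Bool) : ℕ :=
  slotsOf l * objectsOf l

/-- Which objects the slots accept in the matching problem of a string. -/
def acceptsOf (l : List Bool) : ℕ → ℕ → Prop :=
  Accepts (agentsOf l) (objectsOf l) (prefOf l)

/-- The pointers of deferred acceptance as array `1`: it consists of one row of `proposalsOf`
bits for each slot, and the number of bits `true` in the row is the pointer. Array `0` is the
string that presents the assignment problem. -/
noncomputable def pointerOf (A : Fin 2 → List Bool) (x : ℕ) : ℕ :=
  countBelow (proposalsOf (A 0)) fun j => (A 1)[x * proposalsOf (A 0) + j]? = some true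

/-- Set all pointers to zero. -/
noncomputable def initPointers : (Fin 2 → List Bool) → Fin 2 → List Bool :=
  fill 1 (fun A => slotsOf (A 0) * proposalsOf (A 0)) fun _ _ => False

/-- One round of deferred acceptance on the array of pointers. -/
noncomputable def roundPointers : (Fin 2 → List Bool) → Fin 2 → List Bool :=
  fill 1 (fun A => (A 1).length) fun y A => (A 1)[y]? = some true ∨
    y % proposalsOf (A 0) = pointerOf A (y / proposalsOf (A 0)) ∧
      DeferredAcceptance.Rejected (slotsOf (A 0)) (objectsOf (A 0)) (acceptsOf (A 0)) (pointerOf A)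
        (y / proposalsOf (A 0))

/-- The number of rounds after which deferred acceptance has come to an end. -/
noncomputable def roundsOf (l : List Bool) : ℕ :=
  slotsOf l * proposalsOf l + 1

/-! ### The decision procedure takes polynomial time -/

section

variable {c : ℕ} {f g h : (Fin c → ℕ) → (Fin 2 → List Bool) → ℕ}

theorem polyTerm_blockLength (hf : PolyTerm f) : PolyTerm fun v A => blockLength (A 0) (f v A) :=
  (PolyTerm.length 0).count (φ := fun x v A => ∀ y < x + 1, (A 0)[f v A + y]? = some true)
    (PolyPred.all (φ := fun y (v : Fin (c + 1) → ℕ) A =>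
      (A 0)[f (fun j => v j.succ) A + y]? = some true) ((PolyTerm.var 0).add .one)
      (PolyPred.bit 0 (hf.shift.shift.add (.var 0))))

theorem polyTerm_agentsOf : PolyTerm (r := 2) fun (_ : Fin c → ℕ) A => agentsOf (A 0) :=
  polyTerm_blockLength .zero

theorem polyTerm_objectsOf : PolyTerm (r := 2) fun (_ : Fin c → ℕ) A => objectsOf (A 0) :=
  polyTerm_blockLength (polyTerm_agentsOf.add .one)

theorem polyPred_prefOf (hf : PolyTerm f) (hg : PolyTerm g) (hh : PolyTerm h) :
    PolyPred fun v A => prefOf (A 0) (f v A) (g v A) (h v A) :=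
  PolyPred.bit 0 (((polyTerm_agentsOf.add polyTerm_objectsOf).add (PolyTerm.one.add .one)).add
    ((((hf.mul polyTerm_objectsOf).add hg).mul polyTerm_objectsOf).add hh))

theorem polyTerm_quota :
    PolyTerm (r := 2) fun (_ : Fin c → ℕ) A => quota (agentsOf (A 0)) (objectsOf (A 0)) :=
  polyTerm_objectsOf.count (φ := fun j _ A => j * agentsOf (A 0) < objectsOf (A 0))
    (.lt ((PolyTerm.var 0).mul polyTerm_agentsOf) polyTerm_objectsOf)

theorem polyTerm_slotsOf : PolyTerm (r := 2) fun (_ : Fin c → ℕ) A => slotsOf (A 0) :=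
  polyTerm_agentsOf.mul polyTerm_quota

theorem polyTerm_proposalsOf : PolyTerm (r := 2) fun (_ : Fin c → ℕ) A => proposalsOf (A 0) :=
  polyTerm_slotsOf.mul polyTerm_objectsOf

theorem polyPred_acceptsOf (hf : PolyTerm f) (hg : PolyTerm g) :
    PolyPred fun v A => acceptsOf (A 0) (f v A) (g v A) :=
  .le (polyTerm_objectsOf.count (φ := fun a v A => ¬ prefOf (A 0)
      (f v A / quota (agentsOf (A 0)) (objectsOf (A 0))) (g v A) a)
      (polyPred_prefOf (hf.shift.div polyTerm_quota) hg.shift (.var 0)).not)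
    ((hf.mod polyTerm_quota).mul polyTerm_agentsOf)

theorem polyTerm_pointerOf (hf : PolyTerm f) : PolyTerm fun v A => pointerOf A (f v A) :=
  polyTerm_proposalsOf.count
    (φ := fun j v A => (A 1)[f v A * proposalsOf (A 0) + j]? = some true)
    (PolyPred.bit 1 ((hf.shift.mul polyTerm_proposalsOf).add (.var 0)))

theorem polyPred_beats (hf : PolyTerm f) (hg : PolyTerm g) :
    PolyPred fun v A => DeferredAcceptance.Beats (slotsOf (A 0)) (objectsOf (A 0))
      (acceptsOf (A 0)) (pointerOf A) (f v A) (g v A) :=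
  have hf' := polyTerm_pointerOf hf
  have hg' := polyTerm_pointerOf hg
  .and (.lt hf' polyTerm_proposalsOf)
    (.and (.eq (hf'.mod polyTerm_objectsOf) (hg'.mod polyTerm_objectsOf))
      (.and (polyPred_acceptsOf hf (hg'.mod polyTerm_objectsOf))
        (.or (.lt hg' hf') (.and (.eq hg' hf') (.lt hf hg)))))

theorem polyPred_rejected (hf : PolyTerm f) :
    PolyPred fun v A => DeferredAcceptance.Rejected (slotsOf (A 0)) (objectsOf (A 0))
      (acceptsOf (A 0)) (pointerOf A) (f v A) :=
  have hf' := polyTerm_pointerOf hf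
  .and (.lt hf' polyTerm_proposalsOf)
    (.or (polyPred_acceptsOf hf (hf'.mod polyTerm_objectsOf)).not
      (.ex (φ := fun x' v A => DeferredAcceptance.Beats (slotsOf (A 0)) (objectsOf (A 0))
        (acceptsOf (A 0)) (pointerOf A) x' (f v A)) polyTerm_slotsOf
        (polyPred_beats (.var 0) hf.shift)))

theorem polyCmd_initPointers : PolyCmd initPointers :=
  .fill 1 (polyTerm_slotsOf.mul polyTerm_proposalsOf)
    ((PolyPred.lt .zero .zero).of_iff fun _ _ => by simp)

theorem polyCmd_roundPointers : PolyCmd roundPointers :=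
  have hdiv := (PolyTerm.var (r := 2) (0 : Fin 1)).div polyTerm_proposalsOf
  .fill 1 (.length 1) (.or (.bit 1 (.var 0))
    (.and (.eq ((PolyTerm.var 0).mod polyTerm_proposalsOf) (polyTerm_pointerOf hdiv))
      (polyPred_rejected hdiv)))

theorem polyTerm_roundsOf : PolyTerm (r := 2) fun (_ : Fin c → ℕ) A => roundsOf (A 0) :=
  (polyTerm_slotsOf.mul polyTerm_proposalsOf).add .one

theorem length_roundPointers (A : Fin 2 → List Bool) (a : Fin 2) :
    (roundPointers A a).length = (A a).length := by
  unfold roundPointers fill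
  by_cases ha : a = 1
  · subst ha
    simp
  · rw [update_of_ne ha]

end

/-! ### Correctness of the decision procedure -/

open DeferredAcceptance in
theorem rejected_congr {s m : ℕ} {nb : ℕ → ℕ → Prop} {t u : ℕ → ℕ} (h : ∀ x < s, t x = u x)
    {x : ℕ} (hx : x < s) : Rejected s m nb t x ↔ Rejected s m nb u x := by
  have hb : ∀ x' < s, (Beats s m nb t x' x ↔ Beats s m nb u x' x) := fun x' hx' => by
    unfold Beats
    rw [h x hx, h x' hx']
  unfold Rejected
  rw [h x hx]
  exact and_congr_right fun _ => or_congr_right (exists_congr fun x' => and_congr_right (hb x'))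

open Classical in
/-- The array of pointers that stands for `t`. -/
noncomputable def pointerArray (l : List Bool) (t : ℕ → ℕ) : Fin 2 → List Bool :=
  ![l, (List.range (slotsOf l * proposalsOf l)).map fun y =>
    decide (y % proposalsOf l < t (y / proposalsOf l))]

theorem initPointers_eq (l l' : List Bool) : initPointers ![l, l'] = pointerArray l fun _ => 0 := by
  funext a
  fin_cases a <;> simp [initPointers, fill, pointerArray]

/-- The row of `x` in the array that stands for `t` has `t x` bits `true`. -/
theorem pointerOf_pointerArray {l : List Bool} {t : ℕ → ℕ} {x : ℕ} (hx : x < slotsOf l)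
    (ht : t x ≤ proposalsOf l) : pointerOf (pointerArray l t) x = t x := by
  refine countBelow_eq_of_lt ht fun j hj => ?_
  change j < proposalsOf l at hj
  have h1 : x * proposalsOf l + j < slotsOf l * proposalsOf l := by
    have : (x + 1) * proposalsOf l ≤ slotsOf l * proposalsOf l := Nat.mul_le_mul_right _ hx
    rw [Nat.succ_mul] at this
    omega
  have e1 : (x * proposalsOf l + j) / proposalsOf l = x := by
    rw [Nat.add_comm, Nat.add_mul_div_right _ _ (by omega), Nat.div_eq_of_lt hj, zero_add]
  have e2 : (x * proposalsOf l + j) % proposalsOf l = j := by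
    rw [Nat.add_comm, Nat.add_mul_mod_self_right, Nat.mod_eq_of_lt hj]
  simp [pointerArray, h1, e1, e2]

theorem roundPointers_pointerArray {l : List Bool} {t : ℕ → ℕ}
    (ht : ∀ x < slotsOf l, t x ≤ proposalsOf l) :
    roundPointers (pointerArray l t) = pointerArray l
      (DeferredAcceptance.round (slotsOf l) (objectsOf l) (acceptsOf l) t) := by
  classical
  funext a
  by_cases ha : a = 1
  · subst ha
    have e : ∀ t, pointerArray l t 1 = (List.range (slotsOf l * proposalsOf l)).map fun y =>
        decide (y % proposalsOf l < t (y / proposalsOf l)) := fun _ => rfl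
    have e0 : pointerArray l t 0 = l := rfl
    unfold roundPointers fill
    rw [update_self]
    beta_reduce
    rw [e0, e, e, List.length_map, List.length_range]
    refine List.map_congr_left fun y hy => ?_
    rw [List.mem_range] at hy
    have hx : y / proposalsOf l < slotsOf l :=
      Nat.div_lt_of_lt_mul (by rwa [Nat.mul_comm])
    rw [decide_eq_decide, rejected_congr (u := t)
      (fun x hx => pointerOf_pointerArray hx (ht x hx)) hx,
      pointerOf_pointerArray hx (ht _ hx)]
    have : ((List.range (slotsOf l * proposalsOf l)).map fun y =>
        decide (y % proposalsOf l < t (y / proposalsOf l)))[y]? = some true ↔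
        y % proposalsOf l < t (y / proposalsOf l) := by simp [hy]
    rw [this]
    unfold DeferredAcceptance.round
    split_ifs with hr
    · simp only [hr, and_true]
      omega
    · simp only [hr, and_false, or_false]
  · have : a = 0 := by omega
    subst this
    rfl

theorem iterate_roundPointers (l : List Bool) (i : ℕ) :
    roundPointers^[i] (pointerArray l fun _ => 0) = pointerArray l
      ((DeferredAcceptance.round (slotsOf l) (objectsOf l) (acceptsOf l))^[i] fun _ => 0) := by
  induction i with
  | zero => rfl
  | succ i ih =>
    rw [iterate_succ_apply', ih, roundPointers_pointerArray, iterate_succ_apply']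
    exact fun x hx => (DeferredAcceptance.inv_zero.iterate i x hx).1

/-- The answer that the procedure reads off the final pointers. -/
def Accepted (A : Fin 2 → List Bool) : Prop :=
  (0 < agentsOf (A 0) ∨ objectsOf (A 0) = 0) ∧
    ∀ x < slotsOf (A 0), pointerOf A x < proposalsOf (A 0)

theorem polyPred_accepted : PolyPred fun (_ : Fin 0 → ℕ) A => Accepted A :=
  .and (.or (.pos polyTerm_agentsOf) (.eq polyTerm_objectsOf .zero))
    (.all (φ := fun x _ A => pointerOf A x < proposalsOf (A 0)) polyTerm_slotsOf
      (.lt (polyTerm_pointerOf (.var 0)) polyTerm_proposalsOf))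

theorem accepted_iff (l : List Bool) :
    Accepted (roundPointers^[roundsOf l] (initPointers ![l, []])) ↔
      (0 < agentsOf l ∨ objectsOf l = 0) ∧
        HasMatching (slotsOf l) (objectsOf l) (acceptsOf l) := by
  rw [initPointers_eq, iterate_roundPointers, DeferredAcceptance.hasMatching_iff]
  refine and_congr Iff.rfl (forall₂_congr fun x hx => ?_)
  change x < slotsOf l at hx
  have h0 := pointerOf_pointerArray hx (DeferredAcceptance.inv_zero (nb := acceptsOf l)
    |>.iterate (roundsOf l) x hx).1
  rw [h0]
  rfl

end

/-! ### Reading the encoding of an assignment problem -/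

theorem blockLength_eq (a : ℕ) (l₀ l : List Bool) :
    blockLength (l₀ ++ (List.replicate a true ++ false :: l)) l₀.length = a := by
  refine countBelow_eq_of_lt ?_ fun x _ => ?_
  · simp
    omega
  · have e : ∀ y, (l₀ ++ (List.replicate a true ++ false :: l))[l₀.length + y]? =
        (List.replicate a true ++ false :: l)[y]? := fun y => by
      rw [List.getElem?_append_right (Nat.le_add_right _ _), Nat.add_sub_cancel_left]
    simp only [e]
    refine ⟨fun h => ?_, fun h y hy => ?_⟩
    · by_contra! hx
      have := h a (by omega)
      simp at this
    · have hya : y < (List.replicate a true).length := by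
        rw [List.length_replicate]
        omega
      rw [List.getElem?_append_left hya, List.getElem?_replicate, if_pos (by omega)]

theorem getElem?_flatMap_finRange {n k : ℕ} (f : Fin n → List Bool) (hf : ∀ i, (f i).length = k)
    (i : Fin n) {j : ℕ} (hj : j < k) :
    ((List.finRange n).flatMap f)[(i : ℕ) * k + j]? = (f i)[j]? := by
  induction n with
  | zero => exact i.elim0
  | succ n ih =>
    rw [List.finRange_succ, List.flatMap_cons, List.flatMap_map]
    refine Fin.cases ?_ (fun i => ?_) i
    · rw [List.getElem?_append_left (by simp [hf, hj])]
      simp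
    · rw [List.getElem?_append_right (by rw [hf, Fin.val_succ, Nat.succ_mul]; omega), hf,
        ← ih (fun i => f i.succ) (fun i => hf _) i]
      congr 1
      rw [Fin.val_succ, Nat.succ_mul]
      omega

namespace AssignmentProblem

variable (I : AssignmentProblem)

theorem agentsOf_encode : agentsOf I.encode = I.n :=
  blockLength_eq I.n [] _

theorem objectsOf_encode : objectsOf I.encode = I.m := by
  unfold objectsOf
  rw [agentsOf_encode]
  have := blockLength_eq I.m (List.replicate I.n true ++ [false])
    ((List.finRange I.n).flatMap fun i =>
      (List.finRange I.m).flatMap fun a =>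
        (List.finRange I.m).map fun b => I.pref i a b)
  rw [List.length_append, List.length_replicate, List.length_singleton, List.append_assoc] at this
  exact this

theorem prefOf_encode (i : Fin I.n) (a b : Fin I.m) :
    prefOf I.encode i a b ↔ I.pref i a b = true := by
  unfold prefOf
  rw [agentsOf_encode, objectsOf_encode]
  have e : I.encode = (List.replicate I.n true ++ [false] ++
      (List.replicate I.m true ++ [false])) ++
      ((List.finRange I.n).flatMap fun i => (List.finRange I.m).flatMap fun a =>
        (List.finRange I.m).map fun b => I.pref i a b) := by
    simp [encode]
  have e1 : (List.replicate I.n true ++ [false] ++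
      (List.replicate I.m true ++ [false])).length = I.n + I.m + 2 := by
    simp
    omega
  have h1 : (a : ℕ) * I.m + b < I.m * I.m := by
    have : ((a : ℕ) + 1) * I.m ≤ I.m * I.m := Nat.mul_le_mul_right _ a.2
    rw [Nat.succ_mul] at this
    omega
  have e2 : ((i : ℕ) * I.m + a) * I.m + b = i * (I.m * I.m) + (a * I.m + b) := by ring
  rw [e, List.getElem?_append_right (by rw [e1]; omega), e1, Nat.add_sub_cancel_left, e2,
    getElem?_flatMap_finRange (k := I.m * I.m) _ (fun i => by simp [List.length_flatMap]) i h1,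
    getElem?_flatMap_finRange (k := I.m) _ (fun a => by simp) a b.2]
  simp

end AssignmentProblem

theorem mainTheorem2 :
    DecidableInPolyTime AssignmentProblem.encode
      (fun I => ∃ p : Fin I.n → Fin I.m → ℝ, I.IsDiscreteAssignment p ∧ I.IsSDProportional p) := by
  classical
  have hcmd : PolyCmd fun A => roundPointers^[roundsOf (initPointers A 0)] (initPointers A) :=
    (polyCmd_roundPointers.iterate length_roundPointers polyTerm_roundsOf).comp
      polyCmd_initPointers
  refine ⟨fun I => decide (∃ p, I.IsDiscreteAssignment p ∧ I.IsSDProportional p),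
    fun I => decide_eq_true_iff, hcmd.computableInPolyTime polyPred_accepted fun I => ?_⟩
  have h1 : initPointers ![I.encode, []] 0 = I.encode := rfl
  rw [h1, accepted_iff, decide_eq_true_iff, I.exists_isSDProportional_iff I.prefOf_encode]
  unfold acceptsOf slotsOf
  rw [I.agentsOf_encode, I.objectsOf_encode]
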